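/- **Setting.** Let $N\ge 2$, let $d,k$ be positive integers, and let $\Omega\subset\mathbb R^N$ be non-empty, open and bounded with Lipschitz boundary. Let $f\in L^\infty(\Omega;\mathbb R^d)$, and let $\sigma_1,\sigma_2$ be symmetric linear maps on $\mathbb R^{dN^k}$ such that, for some $M>0$, $$\tfrac1M|P|^2\le\sigma_iP\cdot P\le M|P|^2\qquad\text{for all }P\in\mathbb R^{dN^k},\ i=1,2 .$$ For a Borel set $A\subset\mathbb R^N$ put $\sigma_A=\mathbf 1_A\sigma_1+\mathbf 1_{\Omega\setminus A}\sigma_2$. Let $\mathcal A=\sum_{|\alpha|=k}A_\alpha\partial^\alpha$, with $A_\alpha\in\mathrm{Lin}(\mathbb R^d;\mathbb R^{dN^k})$. For open $\omega\subset\mathbb R^N$ let $W^{\mathcal A}(\omega)=\{u\in L^2(\omega;\mathbb R^d):\mathcal Au\in L^2(\omega;\mathbb R^{dN^k})\}$ (derivatives in the sense of distributions), with norm $(\|u\|_{L^2}^2+\|\mathcal Au\|_{L^2}^2)^{1/2}$, and let $W^{\mathcal A}_0(\Omega)$ be the closure of $C_c^\infty(\Omega;\mathbb R^d)$ in $W^{\mathcal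 A}(\Omega)$. Assume that $\mathcal A$ is an operator of gradient form, that is: 1. (Compactness) there is a constant $C$ such that $\|\varphi\|^2_{W^{k,2}(\Omega)}\le C(\|\varphi\|^2_{L^2(\Omega)}+\|\mathcal A\varphi\|^2_{L^2(\Omega)})$ for all $\varphi\in C^\infty(\overline\Omega;\mathbb R^d)$, and $\inf\{\|u-v\|^2_{W^{k,2}(\Omega)}:v\in W^{\mathcal A}(\Omega),\ \mathcal Av=0\}\le C\|\mathcal Au\|^2_{L^2(\Omega)}$ for all $u\in W^{\mathcal A}(\Omega)$; 2. (Exactness) there are a subspace $Z\subset\mathbb R^{dN^k}$, a positive integer $n$, and a homogeneous operator $\mathcal B=\sum_{|\alpha|=m}B_\alpha\partial^\alpha$ of some order $m$ with $B_\alpha\in\mathrm{Lin}(Z;\mathbb R^n)$, such that for every simply connected open set $\omega$ with Lipschitz boundary and $\overline\omega\subset\Omega$, $$\{\mathcal Au:u\in W^{\mathcal A}(\omega)\}=\{v\in L^2(\omega;Z):\mathcal Bv=0\text{ in }\mathcal D'(\omega;\mathbb R^n)\}.$$ For a Borel set $A$ of locally finite perimeter write $\mathrm{Per}(A;\overline\Omega)=|\nabla\mathbf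 1_A|(\overline\Omega)$. Fix a Borel set $A_0\subset\mathbb R^N$ of locally finite perimeter. Call $A$ *admissible* if it is a Borel set of locally finite perimeter and $A\cap\Omega^c=A_0\cap\Omega^c$ up to a Lebesgue null set. Let $$I_\Omega(u,A)=\int_\Omega 2f\cdot u\,dx-\int_\Omega\sigma_A\mathcal Au\cdot\mathcal Au\,dx+\mathrm{Per}(A;\overline\Omega).$$ A *solution of problem (P)* is a pair $(w,A)$ with $A$ admissible and $w\in W_0^{\mathcal A}(\Omega)$ such that $$I_\Omega(w,A)=\sup_{u\in W_0^{\mathcal A}(\Omega)}I_\Omega(u,A)=\inf_{A'\text{ admissible}}\ \sup_{u\in W_0^{\mathcal A}(\Omega)}I_\Omega(u,A').$$ **Theorem 1.1 (existence).** (a) Problem (P) has a solution $(w,A)$. (b) For every Borel set $A\subset\mathbb R^N$ the state constraint $$\mathcal A^*(\sigma_A\mathcal Au)=f\ \text{ in }\mathcal D'(\Omega;\mathbb R^d),\qquad u\in W_0^{\mathcal A}(\Omega), \tag{1.4}$$ has a unique solution $w_A$, where $\mathcal A^*=(-1)^k\sum_{|\alpha|=k}A_\alpha^T\partial^\alpha$.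 (c) Consider the optimal design problem $$\text{minimize}\quad E(A)=\int_\Omega f\cdot w_A\,dx+\mathrm{Per}(A;\overline\Omega)\quad\text{among admissible }A. \tag{1.5}$$ The map $(w,A)\mapsto(w_A,A)$ is a bijection from the set of solutions of problem (P) onto the set of pairs $(u,A)$ such that $A$ is a minimizer of (1.5) and $u$ solves (1.4) for $A$. Moreover $w=w_A$ for every solution $(w,A)$ of (P). -/

import Mathlib

open MeasureTheory Set
open scoped ENNReal NNReal ContDiff

noncomputable section

namespace OptimalDesign

/-- `ℝ^N` with the Euclidean norm. -/
abbrev Sp (N : ℕ) : Type := EuclideanSpace ℝ (Fin N)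

/-- The space `ℝ^{d N^k}` of arrays with one index in `{1, …, d}` and `k` indices in
`{1, …, N}`, with the Euclidean norm. -/
abbrev Arr (d N k : ℕ) : Type := EuclideanSpace ℝ (Fin d × (Fin k → Fin N))

/-- `L²(Ω; V)`. -/
abbrev L2 {N : ℕ} (Ω : Set (Sp N)) (V : Type) [NormedAddCommGroup V] : Type :=
  Lp V 2 (volume.restrict Ω)

/-- `L^∞(Ω; V)`. -/
abbrev Linf {N : ℕ} (Ω : Set (Sp N)) (V : Type) [NormedAddCommGroup V] : Type :=
  Lp V ⊤ (volume.restrict Ω)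

section Domains

variable {N : ℕ}

/-- `Ω` has Lipschitz boundary: near each boundary point it is, in suitable orthogonal
coordinates (`ν` being the vertical direction), the strict epigraph of a Lipschitz function of
the horizontal component. -/
def HasLipschitzBoundary (Ω : Set (Sp N)) : Prop :=
  ∀ x ∈ frontier Ω, ∃ r : ℝ, 0 < r ∧ ∃ ν : Sp N, ‖ν‖ = 1 ∧
    ∃ (K : ℝ≥0) (γ : Sp N → ℝ), LipschitzWith K γ ∧
      ∀ y ∈ Metric.ball x r, y ∈ Ω ↔ γ (y - inner ℝ ν y • ν) < inner ℝ ν y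

end Domains

section Derivatives

variable {N : ℕ} {V W : Type} [NormedAddCommGroup V] [InnerProductSpace ℝ V]
  [FiniteDimensional ℝ V] [NormedAddCommGroup W] [InnerProductSpace ℝ W] [FiniteDimensional ℝ W]

/-- `φ ∈ C_c^∞(Ω; V)`. -/
def IsTest (Ω : Set (Sp N)) (φ : Sp N → V) : Prop :=
  ContDiff ℝ ∞ φ ∧ HasCompactSupport φ ∧ tsupport φ ⊆ Ω

/-- The classical partial derivative `∂_i`. -/
def partialDeriv (i : Fin N) (φ : Sp N → V) : Sp N → V :=
  fun x => fderiv ℝ φ x (EuclideanSpace.single i 1)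

/-- `∂^α = ∂_1^{α_1} ⋯ ∂_N^{α_N}` on classically differentiable functions. -/
def multiDeriv (α : Fin N → ℕ) (φ : Sp N → V) : Sp N → V :=
  (List.finRange N).foldr (fun i g => (partialDeriv i)^[α i] g) φ

/-- The finite set of multi-indices `α` with `|α| = k`. -/
abbrev multiIdx (N k : ℕ) : Finset (Fin N → ℕ) := Finset.piAntidiag Finset.univ k

/-- The coefficients `(A_α)` of a homogeneous partial differential operator from `V`-valued to
`W`-valued functions. An operator of order `k` uses only those with `|α| = k`. -/
abbrev Coeffs (N : ℕ) (V W : Type) [NormedAddCommGroup V] [InnerProductSpace ℝ V]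
    [NormedAddCommGroup W] [InnerProductSpace ℝ W] : Type :=
  (Fin N → ℕ) → V →ₗ[ℝ] W

/-- `∑_{|α| = k} A_α ∂^α φ` for smooth `φ`. -/
def applyOp (k : ℕ) (A : Coeffs N V W) (φ : Sp N → V) : Sp N → W :=
  fun x => ∑ α ∈ multiIdx N k, A α (multiDeriv α φ x)

/-- The formal adjoint `(-1)^k ∑_{|α| = k} A_αᵀ ∂^α ψ` for smooth `ψ`. -/
def applyAdj (k : ℕ) (A : Coeffs N V W) (ψ : Sp N → W) : Sp N → V :=
  fun x => (-1 : ℝ) ^ k • ∑ α ∈ multiIdx N k, LinearMap.adjoint (A α) (multiDeriv α ψ x)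

/-- `∑_{|α| = k} A_α ∂^α u = g` in the sense of distributions on `Ω`, where `g ∈ L²(Ω; W)`. -/
def HasWeakOp (k : ℕ) (A : Coeffs N V W) (Ω : Set (Sp N)) (u : L2 Ω V) (g : L2 Ω W) : Prop :=
  ∀ ψ : Sp N → W, IsTest Ω ψ →
    ∫ x in Ω, inner ℝ (u x) (applyAdj k A ψ x) = ∫ x in Ω, inner ℝ (g x) (ψ x)

open Classical in
/-- The function `𝒜 u ∈ L²(Ω; W)`; the value is `0` if the distribution `𝒜 u` is not in `L²`. -/
def weakOp (k : ℕ) (A : Coeffs N V W) (Ω : Set (Sp N)) (u : L2 Ω V) : L2 Ω W :=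
  if h : ∃ g, HasWeakOp k A Ω u g then h.choose else 0

/-- The space `W^𝒜(Ω) = {u ∈ L² : 𝒜 u ∈ L²}`. -/
def WA (k : ℕ) (A : Coeffs N V W) (Ω : Set (Sp N)) : Set (L2 Ω V) :=
  {u | ∃ g, HasWeakOp k A Ω u g}

/-- The space `W_0^𝒜(Ω)`: the closure of `C_c^∞(Ω; V)` in `W^𝒜(Ω)` for the norm
`(‖u‖²_{L²} + ‖𝒜 u‖²_{L²})^{1/2}`. -/
def WA0 (k : ℕ) (A : Coeffs N V W) (Ω : Set (Sp N)) : Set (L2 Ω V) :=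
  {u | u ∈ WA k A Ω ∧ ∀ ε : ℝ≥0∞, 0 < ε → ∃ φ : Sp N → V, IsTest Ω φ ∧
    eLpNorm (fun x => u x - φ x) 2 (volume.restrict Ω) ^ 2 +
      eLpNorm (fun x => weakOp k A Ω u x - applyOp k A φ x) 2 (volume.restrict Ω) ^ 2 < ε}

/-- `∂^α u = g` in the sense of distributions on `Ω`. -/
def HasWeakDeriv (Ω : Set (Sp N)) (α : Fin N → ℕ) (u g : L2 Ω V) : Prop :=
  ∀ ψ : Sp N → V, IsTest Ω ψ →
    ∫ x in Ω, inner ℝ (u x) (multiDeriv α ψ x) =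
      (-1 : ℝ) ^ (∑ i, α i) * ∫ x in Ω, inner ℝ (g x) (ψ x)

/-- `‖u‖²_{W^{k,2}(Ω)} = ∑_{|α| ≤ k} ‖∂^α u‖²_{L²(Ω)}`, which is `∞` if some weak derivative of
order at most `k` fails to exist in `L²`. -/
def sobolevNormSq (k : ℕ) (Ω : Set (Sp N)) (u : L2 Ω V) : ℝ≥0∞ :=
  ∑ j ∈ Finset.range (k + 1), ∑ α ∈ multiIdx N j,
    ⨅ (g : L2 Ω V) (_ : HasWeakDeriv Ω α u g), eLpNorm g 2 (volume.restrict Ω) ^ 2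

/-- `‖φ‖²_{W^{k,2}(Ω)}` for a smooth function `φ`. -/
def smoothSobolevNormSq (k : ℕ) (Ω : Set (Sp N)) (φ : Sp N → V) : ℝ≥0∞ :=
  ∑ j ∈ Finset.range (k + 1), ∑ α ∈ multiIdx N j,
    eLpNorm (multiDeriv α φ) 2 (volume.restrict Ω) ^ 2

end Derivatives

section GradientForm

variable {N d k : ℕ}

/-- The compactness property: the Korn-type inequality on `C^∞(Ω̄; ℝ^d)` (the restrictions of
smooth functions on `ℝ^N`) and the Poincaré inequality modulo the kernel of `𝒜` on `W^𝒜(Ω)`. -/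
def CompactnessProperty (Ω : Set (Sp N)) (A : Coeffs N (Sp d) (Arr d N k)) : Prop :=
  ∃ C : ℝ≥0,
    (∀ φ : Sp N → Sp d, ContDiff ℝ ∞ φ →
      smoothSobolevNormSq k Ω φ ≤
        C * (eLpNorm φ 2 (volume.restrict Ω) ^ 2 +
          eLpNorm (applyOp k A φ) 2 (volume.restrict Ω) ^ 2)) ∧
    ∀ u ∈ WA k A Ω,
      ⨅ (v : L2 Ω (Sp d)) (_ : HasWeakOp k A Ω v 0), sobolevNormSq k Ω (u - v) ≤
        C * eLpNorm (weakOp k A Ω u) 2 (volume.restrict Ω) ^ 2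

/-- The exactness property: there are a subspace `Z` and a homogeneous operator `ℬ` of some order
`m`, with coefficients in `Lin(Z; ℝ^n)`, such that
`{𝒜 u : u ∈ W^𝒜(G)} = {v ∈ L²(G; Z) : ℬ v = 0}` for all simply connected Lipschitz `G ⊂⊂ Ω`. -/
def ExactnessProperty (Ω : Set (Sp N)) (A : Coeffs N (Sp d) (Arr d N k)) : Prop :=
  ∃ (Z : Submodule ℝ (Arr d N k)) (n m : ℕ) (_ : 0 < n) (B : Coeffs N Z (Sp n)),
    ∀ G : Set (Sp N), IsOpen G → closure G ⊆ Ω → HasLipschitzBoundary G →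
      SimplyConnectedSpace G →
      ∀ g : L2 G (Arr d N k),
        (∃ u : L2 G (Sp d), HasWeakOp k A G u g) ↔
          ∃ v : L2 G Z, (∀ᵐ x ∂(volume.restrict G), (v x : Arr d N k) = g x) ∧
            HasWeakOp m B G v 0

/-- Operators of gradient form on `Ω`, of order `k`. -/
def IsGradientForm (Ω : Set (Sp N)) (A : Coeffs N (Sp d) (Arr d N k)) : Prop :=
  CompactnessProperty Ω A ∧ ExactnessProperty Ω A

end GradientForm

section Perimeter

variable {N : ℕ}

/-- The divergence of a vector field. -/
def divergence (T : Sp N → Sp N) (x : Sp N) : ℝ :=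
  ∑ i, partialDeriv i T x i

/-- The total variation on the open set `U` of the distributional gradient of `𝟙_A`. -/
def variationOpen (A U : Set (Sp N)) : ℝ≥0∞ :=
  ⨆ (T : Sp N → Sp N) (_ : IsTest U T ∧ ∀ x, ‖T x‖ ≤ 1),
    ENNReal.ofReal (∫ x in A, divergence T x)

/-- `Per(A; S) = |μ_A|(S)`, the total variation of the Gauss–Green measure `μ_A = ∇ 𝟙_A`,
extended from open sets to arbitrary sets by outer regularity. -/
def Per (A S : Set (Sp N)) : ℝ≥0∞ :=
  ⨅ (U : Set (Sp N)) (_ : IsOpen U ∧ S ⊆ U), variationOpen A U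

/-- `A` is a Borel set of locally finite perimeter. -/
def IsLocallyFinitePerimeter (A : Set (Sp N)) : Prop :=
  MeasurableSet A ∧ ∀ K : Set (Sp N), IsCompact K → Per A K < ⊤

end Perimeter

section Problems

variable {N d k : ℕ}

/-- `σ_A = 𝟙_A σ₁ + 𝟙_{Ω ∖ A} σ₂`. -/
def sigma (Ω : Set (Sp N)) (σ₁ σ₂ : Arr d N k →ₗ[ℝ] Arr d N k) (A : Set (Sp N)) (x : Sp N) :
    Arr d N k →ₗ[ℝ] Arr d N k :=
  A.indicator (fun _ => σ₁) x + (Ω \ A).indicator (fun _ => σ₂) x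

/-- `u` solves the state constraint `𝒜^*(σ_A 𝒜 u) = f` in `𝒟'(Ω; ℝ^d)`, `u ∈ W_0^𝒜(Ω)`. -/
def IsState (Ω : Set (Sp N)) (op : Coeffs N (Sp d) (Arr d N k))
    (σ₁ σ₂ : Arr d N k →ₗ[ℝ] Arr d N k) (f : Linf Ω (Sp d))
    (A : Set (Sp N)) (u : L2 Ω (Sp d)) : Prop :=
  u ∈ WA0 k op Ω ∧ ∀ φ : Sp N → Sp d, IsTest Ω φ →
    ∫ x in Ω, inner ℝ (sigma Ω σ₁ σ₂ A x (weakOp k op Ω u x)) (applyOp k op φ x) =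
      ∫ x in Ω, inner ℝ (f x) (φ x)

open Classical in
/-- The solution `w_A` of the state constraint (`0` if there is none). -/
def stateSol (Ω : Set (Sp N)) (op : Coeffs N (Sp d) (Arr d N k))
    (σ₁ σ₂ : Arr d N k →ₗ[ℝ] Arr d N k) (f : Linf Ω (Sp d)) (A : Set (Sp N)) : L2 Ω (Sp d) :=
  if h : ∃ u, IsState Ω op σ₁ σ₂ f A u then h.choose else 0

/-- Admissible designs: Borel sets of locally finite perimeter that coincide with `A₀` outside
`Ω`, up to Lebesgue null sets. -/
def IsAdmissible (Ω A₀ A : Set (Sp N)) : Prop :=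
  IsLocallyFinitePerimeter A ∧ (A ∩ Ωᶜ : Set (Sp N)) =ᵐ[volume] (A₀ ∩ Ωᶜ : Set (Sp N))

/-- The functional
`I_Ω(u, A) = ∫_Ω 2 f u dx - ∫_Ω σ_A 𝒜 u · 𝒜 u dx + Per(A; Ω̄)`. -/
def energyI (Ω : Set (Sp N)) (op : Coeffs N (Sp d) (Arr d N k))
    (σ₁ σ₂ : Arr d N k →ₗ[ℝ] Arr d N k) (f : Linf Ω (Sp d))
    (u : L2 Ω (Sp d)) (A : Set (Sp N)) : EReal :=
  (((∫ x in Ω, 2 * inner ℝ (f x) (u x)) -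
    ∫ x in Ω, inner ℝ (sigma Ω σ₁ σ₂ A x (weakOp k op Ω u x)) (weakOp k op Ω u x) : ℝ) : EReal) +
    (Per A (closure Ω) : EReal)

/-- `sup {I_Ω(u, A) : u ∈ W_0^𝒜(Ω)}`. -/
def supI (Ω : Set (Sp N)) (op : Coeffs N (Sp d) (Arr d N k))
    (σ₁ σ₂ : Arr d N k →ₗ[ℝ] Arr d N k) (f : Linf Ω (Sp d)) (A : Set (Sp N)) : EReal :=
  ⨆ u ∈ WA0 k op Ω, energyI Ω op σ₁ σ₂ f u A

/-- `(w, A)` solves the problem `inf_A sup_u I_Ω(u, A)`: the infimum is attained at the admissible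
design `A`, and the supremum for this `A` is attained at `w ∈ W_0^𝒜(Ω)`. -/
def IsSolutionP (Ω : Set (Sp N)) (op : Coeffs N (Sp d) (Arr d N k))
    (σ₁ σ₂ : Arr d N k →ₗ[ℝ] Arr d N k) (f : Linf Ω (Sp d)) (A₀ : Set (Sp N))
    (w : L2 Ω (Sp d)) (A : Set (Sp N)) : Prop :=
  IsAdmissible Ω A₀ A ∧ w ∈ WA0 k op Ω ∧
    energyI Ω op σ₁ σ₂ f w A = supI Ω op σ₁ σ₂ f A ∧
    supI Ω op σ₁ σ₂ f A = ⨅ (A' : Set (Sp N)) (_ : IsAdmissible Ω A₀ A'), supI Ω op σ₁ σ₂ f A'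

/-- `E(A) = ∫_Ω f w_A dx + Per(A; Ω̄)`. -/
def energyE (Ω : Set (Sp N)) (op : Coeffs N (Sp d) (Arr d N k))
    (σ₁ σ₂ : Arr d N k →ₗ[ℝ] Arr d N k) (f : Linf Ω (Sp d)) (A : Set (Sp N)) : EReal :=
  ((∫ x in Ω, inner ℝ (f x) (stateSol Ω op σ₁ σ₂ f A x) : ℝ) : EReal) +
    (Per A (closure Ω) : EReal)

/-- `(u, A)` solves the optimal design problem under the state constraint: `u` is a state for the
admissible design `A`, and `A` minimizes `E` among admissible designs. -/
def IsOptimalDesign (Ω : Set (Sp N)) (op : Coeffs N (Sp d) (Arr d N k))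
    (σ₁ σ₂ : Arr d N k →ₗ[ℝ] Arr d N k) (f : Linf Ω (Sp d)) (A₀ : Set (Sp N))
    (u : L2 Ω (Sp d)) (A : Set (Sp N)) : Prop :=
  IsAdmissible Ω A₀ A ∧ IsState Ω op σ₁ σ₂ f A u ∧
    ∀ A' : Set (Sp N), IsAdmissible Ω A₀ A' →
      energyE Ω op σ₁ σ₂ f A ≤ energyE Ω op σ₁ σ₂ f A'

end Problems

end OptimalDesign

end

open OptimalDesign

/-! For a fixed design the inner problem is a coercive quadratic one. Write J(u, A) for I(u, A)
without the perimeter. If w solves the state equation for A, symmetry and ellipticity of σ_A allow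
completing the square: J(u, A) + (1/M) ‖𝒜u − 𝒜w‖² ≤ ∫ f·w = J(w, A). With the Poincaré inequality
‖u‖² ≤ C ‖𝒜u‖² on W_0^𝒜, the state w_A is the only maximizer and sup_u I(u, A) = E(A). Uniqueness of
the state and the equivalence of the two problems follow from this identity; existence of the state
is Lax–Milgram on the closed graph of 𝒜 over test functions (`exists_mem_forall_inner_eq`).

The Poincaré inequality (`exists_integral_norm_sq_le_applyOp`) comes from the Korn inequality by
scaling. Compressing a test function by a factor c multiplies the k-th order terms by c^{2k}
relative to the L² term, which can then be absorbed for large c by means of the ordinary Poincaré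
inequality for ∂_1^k.

An optimal design is found by the direct method (`exists_isAdmissible_supI_eq`). The competitor u =
0 bounds the perimeters along a minimizing sequence, and a subsequence converges almost everywhere.
For each fixed u, J(u, ·) is continuous under this convergence and the perimeter is lower
semicontinuous, so I(u, A) is at most the infimum; taking the supremum over u finishes the argument,
and no convergence of states is needed.

Two points about perimeter need care. Lower semicontinuity on the closed set Ω̄ fails in general; it
holds here because all designs agree with A₀ outside Ω, so in a thin neighbourhood of Ω̄ the
variation off Ω̄ is that of A₀ and is small (`Per_le_of_tendsto`). Compactness
(`exists_subseq_ae_eventually_mem_iff`) combines weak-* compactness of indicators in the dual of L¹,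
which makes averages over small balls converge pointwise, with the translation estimate, which shows
that averaging at radius r costs O(r) uniformly along the sequence. -/

noncomputable section

namespace OptimalDesign

open Filter Topology

set_option linter.unusedSectionVars false

/-! ### Calculus of test functions and integration by parts -/

section TestFunctions

variable {N : ℕ} {V W : Type} [NormedAddCommGroup V] [InnerProductSpace ℝ V]
  [FiniteDimensional ℝ V] [NormedAddCommGroup W] [InnerProductSpace ℝ W] [FiniteDimensional ℝ W]

theorem contDiff_partialDeriv (i : Fin N) {φ : Sp N → V} (h : ContDiff ℝ ∞ φ) :
    ContDiff ℝ ∞ (partialDeriv i φ) :=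
  (h.fderiv_right (m := ∞) le_rfl).clm_apply contDiff_const

theorem tsupport_partialDeriv_subset (i : Fin N) (φ : Sp N → V) :
    tsupport (partialDeriv i φ) ⊆ tsupport φ :=
  tsupport_fderiv_apply_subset ℝ _

theorem hasCompactSupport_of_tsupport_subset {φ : Sp N → V} {ψ : Sp N → W}
    (h : HasCompactSupport φ) (hs : tsupport ψ ⊆ tsupport φ) : HasCompactSupport ψ :=
  IsCompact.of_isClosed_subset h (isClosed_tsupport _) hs

theorem IsTest.of_tsupport_subset {Ω : Set (Sp N)} {φ : Sp N → V} {ψ : Sp N → W}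
    (h : IsTest Ω φ) (hψ : ContDiff ℝ ∞ ψ) (hs : tsupport ψ ⊆ tsupport φ) : IsTest Ω ψ :=
  ⟨hψ, hasCompactSupport_of_tsupport_subset h.2.1 hs, hs.trans h.2.2⟩

theorem IsTest.mono {Ω Ω' : Set (Sp N)} {φ : Sp N → V} (h : IsTest Ω φ) (hs : Ω ⊆ Ω') :
    IsTest Ω' φ :=
  ⟨h.1, h.2.1, h.2.2.trans hs⟩

theorem isTest_zero (Ω : Set (Sp N)) : IsTest Ω (0 : Sp N → V) :=
  ⟨contDiff_const, HasCompactSupport.zero, by simp [tsupport]⟩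

theorem IsTest.add {Ω : Set (Sp N)} {φ ψ : Sp N → V} (h : IsTest Ω φ) (h' : IsTest Ω ψ) :
    IsTest Ω (φ + ψ) :=
  ⟨h.1.add h'.1, h.2.1.add h'.2.1, (tsupport_add φ ψ).trans (union_subset h.2.2 h'.2.2)⟩

theorem IsTest.const_smul {Ω : Set (Sp N)} {φ : Sp N → V} (c : ℝ) (h : IsTest Ω φ) :
    IsTest Ω (c • φ) :=
  h.of_tsupport_subset (h.1.const_smul c) (closure_mono (Function.support_const_smul_subset c φ))

theorem IsTest.continuous {Ω : Set (Sp N)} {φ : Sp N → V} (h : IsTest Ω φ) : Continuous φ :=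
  h.1.continuous

theorem IsTest.integrable {Ω : Set (Sp N)} {φ : Sp N → V} (h : IsTest Ω φ) :
    Integrable φ :=
  h.continuous.integrable_of_hasCompactSupport h.2.1

theorem IsTest.eq_zero_of_notMem {Ω : Set (Sp N)} {φ : Sp N → V} (h : IsTest Ω φ) {x : Sp N}
    (hx : x ∉ Ω) : φ x = 0 :=
  image_eq_zero_of_notMem_tsupport fun h' => hx (h.2.2 h')

theorem IsTest.partialDeriv {Ω : Set (Sp N)} (i : Fin N) {φ : Sp N → V} (h : IsTest Ω φ) :
    IsTest Ω (partialDeriv i φ) :=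
  h.of_tsupport_subset (contDiff_partialDeriv i h.1) (tsupport_partialDeriv_subset i φ)

theorem multiDeriv_induction {p : (Sp N → V) → Prop}
    (hp : ∀ i φ, p φ → p (OptimalDesign.partialDeriv i φ)) (α : Fin N → ℕ) {φ : Sp N → V}
    (h : p φ) : p (multiDeriv α φ) := by
  unfold multiDeriv
  induction List.finRange N with
  | nil => exact h
  | cons i l ih =>
    rw [List.foldr_cons]
    generalize α i = n
    induction n with
    | zero => exact ih
    | succ n ihn => rw [Function.iterate_succ_apply']; exact hp _ _ ihn

theorem contDiff_multiDeriv (α : Fin N → ℕ) {φ : Sp N → V} (h : ContDiff ℝ ∞ φ) :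
    ContDiff ℝ ∞ (multiDeriv α φ) :=
  multiDeriv_induction (fun i _ => contDiff_partialDeriv i) α h

theorem IsTest.multiDeriv {Ω : Set (Sp N)} (α : Fin N → ℕ) {φ : Sp N → V} (h : IsTest Ω φ) :
    IsTest Ω (multiDeriv α φ) :=
  multiDeriv_induction (fun i _ => IsTest.partialDeriv i) α h

theorem tsupport_multiDeriv_subset (α : Fin N → ℕ) (φ : Sp N → V) :
    tsupport (OptimalDesign.multiDeriv α φ) ⊆ tsupport φ :=
  multiDeriv_induction (p := fun ψ => tsupport ψ ⊆ tsupport φ)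
    (fun i ψ h => (tsupport_partialDeriv_subset i ψ).trans h) α subset_rfl

theorem contDiff_applyOp (k : ℕ) (A : Coeffs N V W) {φ : Sp N → V} (h : ContDiff ℝ ∞ φ) :
    ContDiff ℝ ∞ (applyOp k A φ) :=
  ContDiff.sum fun α _ => (LinearMap.toContinuousLinearMap (A α)).contDiff.comp
    (contDiff_multiDeriv α h)

theorem applyOp_eq_zero_of_notMem (k : ℕ) (A : Coeffs N V W) {φ : Sp N → V} {x : Sp N}
    (hx : x ∉ tsupport φ) : applyOp k A φ x = 0 := by
  refine Finset.sum_eq_zero fun α _ => ?_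
  rw [image_eq_zero_of_notMem_tsupport fun h => hx (tsupport_multiDeriv_subset α φ h), map_zero]

theorem IsTest.applyOp {Ω : Set (Sp N)} (k : ℕ) (A : Coeffs N V W) {φ : Sp N → V}
    (h : IsTest Ω φ) : IsTest Ω (applyOp k A φ) :=
  h.of_tsupport_subset (contDiff_applyOp k A h.1) <|
    closure_minimal (fun _ hx => by_contra fun h' => hx (applyOp_eq_zero_of_notMem k A h'))
      (isClosed_tsupport _)

theorem IsTest.applyAdj {Ω : Set (Sp N)} (k : ℕ) (A : Coeffs N V W) {ψ : Sp N → W}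
    (h : IsTest Ω ψ) : IsTest Ω (applyAdj k A ψ) :=
  (h.applyOp k fun α => LinearMap.adjoint (A α)).const_smul ((-1 : ℝ) ^ k)

theorem partialDeriv_add (i : Fin N) {φ ψ : Sp N → V} (h : ContDiff ℝ ∞ φ)
    (h' : ContDiff ℝ ∞ ψ) : partialDeriv i (φ + ψ) = partialDeriv i φ + partialDeriv i ψ := by
  ext1 x
  simp [partialDeriv, fderiv_add (h.differentiable (by simp) x) (h'.differentiable (by simp) x)]

theorem partialDeriv_const_smul (i : Fin N) (c : ℝ) {φ : Sp N → V} (h : ContDiff ℝ ∞ φ) :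
    partialDeriv i (c • φ) = c • partialDeriv i φ := by
  ext1 x
  simp [partialDeriv, fderiv_const_smul (h.differentiable (by simp) x)]

theorem multiDeriv_add (α : Fin N → ℕ) {φ ψ : Sp N → V} (h : ContDiff ℝ ∞ φ)
    (h' : ContDiff ℝ ∞ ψ) : multiDeriv α (φ + ψ) = multiDeriv α φ + multiDeriv α ψ := by
  unfold multiDeriv
  -- The induction carries the smoothness of the intermediate derivatives, which additivity of the
  -- next ∂_i needs.
  suffices H : ∀ l : List (Fin N), ∃ φ' ψ' : Sp N → V, ContDiff ℝ ∞ φ' ∧ ContDiff ℝ ∞ ψ' ∧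
      l.foldr (fun i g => (partialDeriv i)^[α i] g) φ = φ' ∧
      l.foldr (fun i g => (partialDeriv i)^[α i] g) ψ = ψ' ∧
      l.foldr (fun i g => (partialDeriv i)^[α i] g) (φ + ψ) = φ' + ψ' by
    obtain ⟨_, _, _, _, rfl, rfl, h⟩ := H (List.finRange N)
    exact h
  intro l
  induction l with
  | nil => exact ⟨φ, ψ, h, h', rfl, rfl, rfl⟩
  | cons i l ih =>
    simp only [List.foldr_cons]
    generalize α i = n
    induction n with
    | zero => exact ih
    | succ n ihn =>
      obtain ⟨φ', ψ', h1, h2, h3, h4, h5⟩ := ihn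
      refine ⟨partialDeriv i φ', partialDeriv i ψ', contDiff_partialDeriv i h1,
        contDiff_partialDeriv i h2, ?_, ?_, ?_⟩
      · rw [Function.iterate_succ_apply', h3]
      · rw [Function.iterate_succ_apply', h4]
      · rw [Function.iterate_succ_apply', h5, partialDeriv_add i h1 h2]

theorem multiDeriv_const_smul (α : Fin N → ℕ) (c : ℝ) {φ : Sp N → V} (h : ContDiff ℝ ∞ φ) :
    multiDeriv α (c • φ) = c • multiDeriv α φ := by
  unfold multiDeriv
  suffices H : ∀ l : List (Fin N), ∃ φ' : Sp N → V, ContDiff ℝ ∞ φ' ∧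
      l.foldr (fun i g => (partialDeriv i)^[α i] g) φ = φ' ∧
      l.foldr (fun i g => (partialDeriv i)^[α i] g) (c • φ) = c • φ' by
    obtain ⟨_, _, rfl, h⟩ := H (List.finRange N)
    exact h
  intro l
  induction l with
  | nil => exact ⟨φ, h, rfl, rfl⟩
  | cons i l ih =>
    simp only [List.foldr_cons]
    generalize α i = n
    induction n with
    | zero => exact ih
    | succ n ihn =>
      obtain ⟨φ', h1, h3, h5⟩ := ihn
      refine ⟨partialDeriv i φ', contDiff_partialDeriv i h1, ?_, ?_⟩
      · rw [Function.iterate_succ_apply', h3]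
      · rw [Function.iterate_succ_apply', h5, partialDeriv_const_smul i c h1]

theorem applyOp_add (k : ℕ) (A : Coeffs N V W) {φ ψ : Sp N → V} (h : ContDiff ℝ ∞ φ)
    (h' : ContDiff ℝ ∞ ψ) : applyOp k A (φ + ψ) = applyOp k A φ + applyOp k A ψ := by
  ext1 x
  simp [applyOp, multiDeriv_add _ h h', Finset.sum_add_distrib]

theorem applyOp_const_smul (k : ℕ) (A : Coeffs N V W) (c : ℝ) {φ : Sp N → V}
    (h : ContDiff ℝ ∞ φ) : applyOp k A (c • φ) = c • applyOp k A φ := by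
  ext1 x
  simp [applyOp, multiDeriv_const_smul _ c h, Finset.smul_sum]

theorem partialDeriv_comm (i j : Fin N) {φ : Sp N → V} (h : ContDiff ℝ ∞ φ) :
    partialDeriv i (partialDeriv j φ) = partialDeriv j (partialDeriv i φ) := by
  ext1 x
  have hd : DifferentiableAt ℝ (fderiv ℝ φ) x :=
    (h.fderiv_right (m := ∞) le_rfl).differentiable (by simp) x
  have key : ∀ v w : Sp N, fderiv ℝ (fun y => fderiv ℝ φ y v) x w =
      fderiv ℝ (fderiv ℝ φ) x w v := by
    intro v w
    rw [fderiv_clm_apply hd (differentiableAt_const v)]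
    simp
  have hsymm : IsSymmSndFDerivAt ℝ φ x := h.contDiffAt.isSymmSndFDerivAt (by
    rw [minSmoothness_of_isRCLikeNormedField]; exact WithTop.coe_le_coe.2 (le_top (a := (2 : ℕ∞))))
  unfold partialDeriv
  rw [key, key, hsymm.eq]

theorem integral_inner_partialDeriv (i : Fin N) {φ ψ : Sp N → V} (h : ContDiff ℝ ∞ φ)
    (h' : IsTest univ ψ) :
    ∫ x, inner ℝ (partialDeriv i φ x) (ψ x) = -∫ x, inner ℝ (φ x) (partialDeriv i ψ x) := by
  have hInt : ∀ {a b : Sp N → V}, Continuous a → IsTest univ b →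
      Integrable fun x => innerSL ℝ (a x) (b x) := fun ha hb =>
    (Continuous.inner ha hb.continuous).integrable_of_hasCompactSupport
      (hb.2.1.mono fun x hx hx' => hx (by simp [hx']))
  have := integral_bilinear_fderiv_right_eq_neg_left_of_integrable (μ := volume) (f := φ)
    (g := ψ) (v := EuclideanSpace.single i (1 : ℝ)) (B := innerSL ℝ)
    (hInt (contDiff_partialDeriv i h).continuous h') (hInt h.continuous (h'.partialDeriv i))
    (hInt h.continuous h') (fun x _ => h.differentiable (by simp) x)
    fun x _ => h'.1.differentiable (by simp) x
  exact neg_eq_iff_eq_neg.1 this.symm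

/-- Integration by parts strips the outermost derivative from one factor and makes it the innermost
one on the other. Restoring the canonical order of ∂^α requires commuting ∂_i through the list;
smoothness is carried along for the symmetry of second derivatives. -/
theorem foldr_partialDeriv_comm (α : Fin N → ℕ) (l : List (Fin N)) (i : Fin N) {φ : Sp N → V}
    (h : ContDiff ℝ ∞ φ) :
    l.foldr (fun j g => (partialDeriv j)^[α j] g) (partialDeriv i φ) =
      partialDeriv i (l.foldr (fun j g => (partialDeriv j)^[α j] g) φ) ∧
    ContDiff ℝ ∞ (l.foldr (fun j g => (partialDeriv j)^[α j] g) φ) := by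
  induction l with
  | nil => exact ⟨rfl, h⟩
  | cons j l ih =>
    simp only [List.foldr_cons]
    generalize α j = n
    induction n with
    | zero => exact ih
    | succ n ihn =>
      simp only [Function.iterate_succ_apply']
      exact ⟨by rw [ihn.1, partialDeriv_comm _ _ ihn.2], contDiff_partialDeriv _ ihn.2⟩

theorem integral_inner_multiDeriv (α : Fin N → ℕ) {φ ψ : Sp N → V} (h : IsTest univ φ)
    (h' : IsTest univ ψ) :
    ∫ x, inner ℝ (multiDeriv α φ x) (ψ x) =
      (-1 : ℝ) ^ (∑ i, α i) * ∫ x, inner ℝ (φ x) (multiDeriv α ψ x) := by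
  unfold multiDeriv
  rw [← List.sum_ofFn, List.ofFn_eq_map]
  induction List.finRange N generalizing ψ with
  | nil => simp
  | cons i l ih =>
    simp only [List.foldr_cons, List.map_cons, List.sum_cons]
    generalize α i = n
    have hl : ContDiff ℝ ∞ (l.foldr (fun i g => (partialDeriv i)^[α i] g) φ) := by
      cases N with
      | zero => exact i.elim0
      | succ N => exact (foldr_partialDeriv_comm α l 0 h.1).2
    have hit : ∀ n, ContDiff ℝ ∞ ((OptimalDesign.partialDeriv i)^[n]
        (l.foldr (fun i g => (OptimalDesign.partialDeriv i)^[α i] g) φ)) := by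
      intro n
      induction n with
      | zero => exact hl
      | succ n ihn => rw [Function.iterate_succ_apply']; exact contDiff_partialDeriv i ihn
    induction n generalizing ψ with
    | zero => simpa using ih h'
    | succ n ihn =>
      simp only [Function.iterate_succ_apply']
      rw [integral_inner_partialDeriv i (hit n) h', ihn (h'.partialDeriv i),
        (foldr_partialDeriv_comm α l i h'.1).1, ← Function.iterate_succ_apply,
        Function.iterate_succ_apply']
      ring

/-- Moving k derivatives produces the sign (-1)^k built into `applyAdj`. This is what identifies
classical and weak 𝒜φ for test functions. -/
theorem integral_inner_applyAdj (k : ℕ) (A : Coeffs N V W) {φ : Sp N → V} {ψ : Sp N → W}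
    (h : IsTest univ φ) (h' : IsTest univ ψ) :
    ∫ x, inner ℝ (φ x) (applyAdj k A ψ x) = ∫ x, inner ℝ (applyOp k A φ x) (ψ x) := by
  have hInt : ∀ {a b : Sp N → V}, Continuous a → IsTest univ b →
      Integrable fun x => (inner ℝ (a x) (b x) : ℝ) := fun ha hb =>
    (Continuous.inner ha hb.continuous).integrable_of_hasCompactSupport
      (hb.2.1.mono fun x hx hx' => hx (by simp [hx']))
  have hadj : ∀ α, IsTest univ fun x => LinearMap.adjoint (A α) (ψ x) := fun α =>
    h'.of_tsupport_subset ((LinearMap.toContinuousLinearMap (LinearMap.adjoint (A α))).contDiff.comp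
      h'.1) (closure_mono fun x hx hx' => hx (by simp [hx']))
  -- The coefficients are constant, so they commute with ∂^α.
  have hcomm : ∀ α, (fun x => LinearMap.adjoint (A α) (multiDeriv α ψ x)) =
      multiDeriv α fun x => LinearMap.adjoint (A α) (ψ x) := by
    intro α
    set L := LinearMap.toContinuousLinearMap (LinearMap.adjoint (A α)) with hL
    suffices H : ∀ l : List (Fin N), ∃ ψ' : Sp N → W, ContDiff ℝ ∞ ψ' ∧
        l.foldr (fun i g => (OptimalDesign.partialDeriv i)^[α i] g) ψ = ψ' ∧
        l.foldr (fun i g => (OptimalDesign.partialDeriv i)^[α i] g) (fun x => L (ψ x)) =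
          fun x => L (ψ' x) by
      obtain ⟨_, _, rfl, h⟩ := H (List.finRange N)
      exact h.symm
    intro l
    induction l with
    | nil => exact ⟨ψ, h'.1, rfl, rfl⟩
    | cons i l ih =>
      simp only [List.foldr_cons]
      generalize α i = n
      induction n with
      | zero => exact ih
      | succ n ihn =>
        obtain ⟨φ', h1, h3, h5⟩ := ihn
        refine ⟨OptimalDesign.partialDeriv i φ', contDiff_partialDeriv i h1, ?_, ?_⟩
        · rw [Function.iterate_succ_apply', h3]
        · rw [Function.iterate_succ_apply', h5]
          ext1 x
          have := L.hasFDerivAt.comp x (h1.differentiable (by simp) x).hasFDerivAt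
          unfold OptimalDesign.partialDeriv
          change fderiv ℝ (L ∘ φ') x _ = _
          rw [this.fderiv]
          rfl
  simp only [OptimalDesign.applyAdj, OptimalDesign.applyOp, inner_smul_right, inner_sum, sum_inner]
  rw [integral_const_mul, integral_finsetSum, integral_finsetSum, Finset.mul_sum]
  · refine Finset.sum_congr rfl fun α hα => ?_
    have hα' : ∑ i, α i = k := (Finset.mem_piAntidiag.1 hα).1
    have := integral_inner_multiDeriv α h (hadj α)
    simp only [LinearMap.adjoint_inner_right] at this
    rw [this, hα', ← hcomm α]
  · intro α _
    simp only [← LinearMap.adjoint_inner_right]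
    exact hInt (contDiff_multiDeriv α h.1).continuous (hadj α)
  · intro α _
    rw [show (fun x => inner ℝ (φ x) (LinearMap.adjoint (A α) (multiDeriv α ψ x))) =
      fun x => (inner ℝ (φ x) (multiDeriv α (fun x => LinearMap.adjoint (A α) (ψ x)) x) : ℝ) by
        rw [← hcomm α]]
    exact hInt h.continuous ((hadj α).multiDeriv α)

end TestFunctions

/-! ### Poincaré inequality for 𝒜 by rescaling -/

section Poincare

variable {N : ℕ} {V W : Type} [NormedAddCommGroup V] [InnerProductSpace ℝ V]
  [FiniteDimensional ℝ V] [NormedAddCommGroup W] [InnerProductSpace ℝ W] [FiniteDimensional ℝ W]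

theorem IsTest.integrable_inner {Ω : Set (Sp N)} {φ ψ : Sp N → V} (h : Continuous φ)
    (h' : IsTest Ω ψ) : Integrable fun x => (inner ℝ (φ x) (ψ x) : ℝ) :=
  (h.inner h'.continuous).integrable_of_hasCompactSupport
    (h'.2.1.mono fun x hx hx' => hx (by simp [hx']))

theorem IsTest.integrable_norm_sq {Ω : Set (Sp N)} {φ : Sp N → V} (h : IsTest Ω φ) :
    Integrable fun x => ‖φ x‖ ^ 2 := by
  simpa only [real_inner_self_eq_norm_sq] using IsTest.integrable_inner h.continuous h

/-- Integrating ∂_i φ against x_i φ gives ∫|φ|² = −2 ∫ x_i φ·∂_i φ. Since |x_i| ≤ R on the support,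
Young's inequality absorbs half of the left side. -/
theorem integral_norm_sq_le_partialDeriv {R : ℝ} {φ : Sp N → V} (i : Fin N)
    (h : IsTest (Metric.closedBall 0 R) φ) :
    ∫ x, ‖φ x‖ ^ 2 ≤ 4 * R ^ 2 * ∫ x, ‖partialDeriv i φ x‖ ^ 2 := by
  have hc : ContDiff ℝ ∞ fun x : Sp N => x i :=
    (EuclideanSpace.proj i : Sp N →L[ℝ] ℝ).contDiff
  have hψ : IsTest (Metric.closedBall 0 R) fun x => x i • φ x :=
    h.of_tsupport_subset (hc.smul h.1) (closure_mono fun x hx hx' => hx (by simp [hx']))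
  have hd : ∀ x, partialDeriv i (fun x => x i • φ x) x = φ x + x i • partialDeriv i φ x := by
    intro x
    have h1 : HasFDerivAt (fun x : Sp N => x i)
        (EuclideanSpace.proj i : Sp N →L[ℝ] ℝ) x :=
      (EuclideanSpace.proj i : Sp N →L[ℝ] ℝ).hasFDerivAt
    have h2 := h1.smul (h.1.differentiable (by simp) x).hasFDerivAt
    refine (congrArg (fun L => L (EuclideanSpace.single i 1)) h2.fderiv).trans ?_
    simp [partialDeriv, add_comm]
  have key := integral_inner_partialDeriv i h.1 (hψ.mono (subset_univ _))
  have i1 := h.integrable_norm_sq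
  have i2 := (h.partialDeriv i).integrable_norm_sq
  have i3 : Integrable fun x => x i * inner ℝ (φ x) (partialDeriv i φ x) := by
    simpa only [real_inner_smul_left] using
      IsTest.integrable_inner hψ.continuous (h.partialDeriv i)
  have e1 : ∫ x, inner ℝ (partialDeriv i φ x) (x i • φ x) =
      ∫ x, x i * inner ℝ (φ x) (partialDeriv i φ x) := by
    simp only [real_inner_smul_right, real_inner_comm]
  have e2 : ∫ x, inner ℝ (φ x) (partialDeriv i (fun x => x i • φ x) x) =
      (∫ x, ‖φ x‖ ^ 2) + ∫ x, x i * inner ℝ (φ x) (partialDeriv i φ x) := by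
    simp only [hd, inner_add_right, real_inner_smul_right, real_inner_self_eq_norm_sq]
    exact integral_add i1 i3
  have e3 : ∫ x, ‖φ x‖ ^ 2 = ∫ x, -2 * (x i * inner ℝ (φ x) (partialDeriv i φ x)) := by
    rw [integral_const_mul]
    linarith
  have e4 : ∫ x, -2 * (x i * inner ℝ (φ x) (partialDeriv i φ x)) ≤
      ∫ x, (1 / 2 * ‖φ x‖ ^ 2 + 2 * R ^ 2 * ‖partialDeriv i φ x‖ ^ 2) := by
    refine integral_mono (i3.const_mul _) ((i1.const_mul _).add (i2.const_mul _)) fun x => ?_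
    by_cases hx : x ∈ Metric.closedBall (0 : Sp N) R
    · have h1 : |x i| ≤ R := by
        have := PiLp.norm_apply_le x i
        rw [Real.norm_eq_abs] at this
        exact this.trans (by simpa using hx)
      have h2 := abs_real_inner_le_norm (φ x) (partialDeriv i φ x)
      have h3 : |x i * inner ℝ (φ x) (partialDeriv i φ x)| ≤
          R * (‖φ x‖ * ‖partialDeriv i φ x‖) := by
        rw [abs_mul]
        exact mul_le_mul h1 h2 (abs_nonneg _) ((abs_nonneg _).trans h1)
      have h4 := (abs_le.1 h3).1
      nlinarith [sq_nonneg (‖φ x‖ - 2 * R * ‖partialDeriv i φ x‖)]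
    · simp [h.eq_zero_of_notMem hx]
      positivity
  rw [integral_add (i1.const_mul _) (i2.const_mul _)] at e4
  simp only [integral_const_mul] at e3 e4
  linarith

theorem integral_norm_sq_le_iterate_partialDeriv {R : ℝ} {φ : Sp N → V} (i : Fin N) (k : ℕ)
    (h : IsTest (Metric.closedBall 0 R) φ) :
    ∫ x, ‖φ x‖ ^ 2 ≤ (4 * R ^ 2) ^ k * ∫ x, ‖(partialDeriv i)^[k] φ x‖ ^ 2 := by
  induction k generalizing φ with
  | zero => simp
  | succ k ih =>
    rw [Function.iterate_succ_apply, pow_succ', mul_assoc]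
    exact (integral_norm_sq_le_partialDeriv i h).trans
      (mul_le_mul_of_nonneg_left (ih (h.partialDeriv i)) (by positivity))

theorem multiDeriv_single (i : Fin N) (k : ℕ) (φ : Sp N → V) :
    multiDeriv (Pi.single i k) φ = (partialDeriv i)^[k] φ := by
  have H : ∀ l : List (Fin N), l.Nodup →
      l.foldr (fun j g => (partialDeriv j)^[(Pi.single i k : Fin N → ℕ) j] g) φ =
        if i ∈ l then (partialDeriv i)^[k] φ else φ := by
    intro l hl
    induction l with
    | nil => rfl
    | cons j l ih =>
      rw [List.nodup_cons] at hl
      rw [List.foldr_cons, ih hl.2]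
      by_cases hij : i = j
      · subst hij
        simp [hl.1]
      · simp [hij]
  unfold multiDeriv
  rw [H _ (List.nodup_finRange N), if_pos (List.mem_finRange i)]

theorem contDiff_comp_smul_add (c : ℝ) (b : Sp N) {φ : Sp N → V} (h : ContDiff ℝ ∞ φ) :
    ContDiff ℝ ∞ fun x => φ (c • x + b) :=
  h.comp ((contDiff_const_smul c).add contDiff_const)

theorem partialDeriv_comp_smul_add (i : Fin N) (c : ℝ) (b : Sp N) {φ : Sp N → V}
    (h : ContDiff ℝ ∞ φ) :
    partialDeriv i (fun x => φ (c • x + b)) = fun x => c • partialDeriv i φ (c • x + b) := by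
  ext1 x
  have h1 : HasFDerivAt (fun x : Sp N => c • x + b) (c • ContinuousLinearMap.id ℝ (Sp N)) x :=
    ((hasFDerivAt_id x).const_smul c).add_const b
  have h2 : HasFDerivAt φ (fderiv ℝ φ (c • x + b)) (c • x + b) :=
    (h.differentiable (by simp) _).hasFDerivAt
  have h3 := h2.comp x h1
  unfold partialDeriv
  change fderiv ℝ (φ ∘ fun x => c • x + b) x _ = _
  rw [h3.fderiv]
  simp

theorem multiDeriv_comp_smul_add (α : Fin N → ℕ) (c : ℝ) (b : Sp N) {φ : Sp N → V}
    (h : ContDiff ℝ ∞ φ) :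
    multiDeriv α (fun x => φ (c • x + b)) =
      fun x => c ^ (∑ i, α i) • multiDeriv α φ (c • x + b) := by
  unfold multiDeriv
  rw [← List.sum_ofFn, List.ofFn_eq_map]
  suffices H : ∀ l : List (Fin N),
      ContDiff ℝ ∞ (l.foldr (fun i g => (partialDeriv i)^[α i] g) φ) ∧
      l.foldr (fun i g => (partialDeriv i)^[α i] g) (fun x => φ (c • x + b)) =
        fun x => c ^ (l.map α).sum • l.foldr (fun i g => (partialDeriv i)^[α i] g) φ (c • x + b)
    from (H _).2
  intro l
  induction l with
  | nil => simpa using h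
  | cons i l ih =>
    simp only [List.foldr_cons, List.map_cons, List.sum_cons]
    generalize α i = n
    induction n with
    | zero => simpa using ih
    | succ n ihn =>
      simp only [Function.iterate_succ_apply']
      refine ⟨contDiff_partialDeriv i ihn.1, ?_⟩
      rw [ihn.2]
      have := partialDeriv_const_smul i (c ^ (n + (l.map α).sum))
        (contDiff_comp_smul_add c b ihn.1)
      rw [partialDeriv_comp_smul_add i c b ihn.1] at this
      refine this.trans ?_
      ext1 x
      simp only [Pi.smul_apply, smul_smul]
      congr 1
      ring

theorem applyOp_comp_smul_add (k : ℕ) (A : Coeffs N V W) (c : ℝ) (b : Sp N) {φ : Sp N → V}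
    (h : ContDiff ℝ ∞ φ) :
    applyOp k A (fun x => φ (c • x + b)) = fun x => c ^ k • applyOp k A φ (c • x + b) := by
  ext1 x
  simp only [applyOp, Finset.smul_sum]
  refine Finset.sum_congr rfl fun α hα => ?_
  rw [multiDeriv_comp_smul_add α c b h, (Finset.mem_piAntidiag.1 hα).1, map_smul]

theorem integral_comp_smul_add (F : Sp N → ℝ) {c : ℝ} (hc : 0 < c) (b : Sp N) :
    ∫ x, F (c • x + b) = (c ^ N)⁻¹ * ∫ x, F x := by
  rw [Measure.integral_comp_smul volume (fun y => F (y + b)) c, integral_add_right_eq_self]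
  simp [abs_of_pos hc]

theorem eLpNorm_two_sq {α : Type*} [MeasurableSpace α] {μ : Measure α} {f : α → V}
    (hf : MemLp f 2 μ) : eLpNorm f 2 μ ^ 2 = ENNReal.ofReal (∫ x, ‖f x‖ ^ 2 ∂μ) := by
  rw [hf.eLpNorm_eq_integral_rpow_norm (by simp) (by simp),
    ← ENNReal.ofReal_pow (by positivity)]
  congr 1
  rw [← Real.rpow_natCast, ← Real.rpow_mul (integral_nonneg fun _ => by positivity)]
  simp

theorem IsTest.memLp {Ω : Set (Sp N)} {φ : Sp N → V} (h : IsTest Ω φ) (μ : Measure (Sp N))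
    [IsFiniteMeasureOnCompacts μ] : MemLp φ 2 μ :=
  h.continuous.memLp_of_hasCompactSupport h.2.1

theorem IsTest.setIntegral_eq {Ω : Set (Sp N)} {φ : Sp N → V} (h : IsTest Ω φ)
    (F : Sp N → ℝ) (hF : ∀ x, φ x = 0 → F x = 0) : ∫ x in Ω, F x = ∫ x, F x :=
  setIntegral_eq_integral_of_forall_compl_eq_zero fun _ hx => hF _ (h.eq_zero_of_notMem hx)

theorem IsTest.eLpNorm_sq {Ω : Set (Sp N)} {φ : Sp N → V} (h : IsTest Ω φ) :
    eLpNorm φ 2 (volume.restrict Ω) ^ 2 = ENNReal.ofReal (∫ x, ‖φ x‖ ^ 2) := by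
  rw [eLpNorm_two_sq (h.memLp _), h.setIntegral_eq _ fun x hx => by simp [hx]]

theorem isTest_comp_smul_add {R r c : ℝ} (hc : 0 < c) (hcr : R / c ≤ r) (y : Sp N)
    {φ : Sp N → V} (h : IsTest (Metric.closedBall 0 R) φ) :
    IsTest (Metric.closedBall y r) fun x => φ (c • x + -(c • y)) := by
  have hsub : tsupport (fun x => φ (c • x + -(c • y))) ⊆ Metric.closedBall y r := by
    refine closure_minimal (fun x hx => ?_) Metric.isClosed_closedBall
    have hx' := h.2.2 (subset_tsupport _ (Function.mem_support.2 hx))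
    rw [← sub_eq_add_neg, ← smul_sub, mem_closedBall_zero_iff, norm_smul, Real.norm_eq_abs,
      abs_of_pos hc] at hx'
    rw [mem_closedBall_iff_norm]
    refine le_trans ?_ hcr
    rw [le_div_iff₀ hc]
    linarith
  exact ⟨contDiff_comp_smul_add c _ h.1,
    (isCompact_closedBall y r).of_isClosed_subset (isClosed_tsupport _) hsub, hsub⟩

/-- The Poincaré inequality for `𝒜` on test functions: rescaling the Korn inequality removes its
lower order term. -/
theorem exists_integral_norm_sq_le_applyOp {k : ℕ} (hN : 0 < N) (hk : 0 < k) {Ω : Set (Sp N)}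
    (hΩne : Ω.Nonempty) (hΩo : IsOpen Ω) (hΩb : Bornology.IsBounded Ω) (A : Coeffs N V W)
    (C : ℝ≥0) (hC : ∀ φ : Sp N → V, ContDiff ℝ ∞ φ →
      smoothSobolevNormSq k Ω φ ≤
        C * (eLpNorm φ 2 (volume.restrict Ω) ^ 2 +
          eLpNorm (applyOp k A φ) 2 (volume.restrict Ω) ^ 2)) :
    ∃ C' : ℝ, 0 < C' ∧ ∀ φ : Sp N → V, IsTest Ω φ →
      ∫ x, ‖φ x‖ ^ 2 ≤ C' * ∫ x, ‖applyOp k A φ x‖ ^ 2 := by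
  obtain ⟨y, hy⟩ := hΩne
  obtain ⟨r, hr, hrΩ⟩ := Metric.nhds_basis_closedBall.mem_iff.1 (hΩo.mem_nhds hy)
  obtain ⟨R, hR0, hR⟩ := hΩb.subset_closedBall_lt 0 0
  set P : ℝ := (4 * R ^ 2) ^ k with hP
  have hP0 : 0 < P := by positivity
  -- The bound R / r puts the compressed support in a ball inside Ω, 2CP makes the lower order term
  -- absorbable, and 1 gives c ≤ c^{2k}.
  set c : ℝ := max 1 (max (R / r) (2 * C * P)) with hcdef
  have hc1 : 1 ≤ c := le_max_left _ _
  have hc0 : 0 < c := by linarith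
  have hcR : R / c ≤ r := by
    rw [div_le_iff₀ hc0, ← div_le_iff₀' hr]
    exact (le_max_left _ _).trans (le_max_right _ _)
  have hcP : 2 * C * P ≤ c ^ (2 * k) :=
    ((le_max_right _ _).trans (le_max_right _ _)).trans
      (le_self_pow₀ hc1 (by omega))
  -- The summand 1 keeps the constant positive when C = 0.
  refine ⟨2 * C * P + 1, by positivity, fun φ hφ => ?_⟩
  set i : Fin N := ⟨0, hN⟩
  have hφR := hφ.mono hR
  have ht : IsTest Ω fun x => φ (c • x + -(c • y)) :=
    (isTest_comp_smul_add hc0 hcR y hφR).mono hrΩ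
  have h1 := hC _ ht.1
  -- Of the whole Sobolev norm only the pure derivative ∂_i^k is kept.
  have h2 : eLpNorm (multiDeriv (Pi.single i k) fun x => φ (c • x + -(c • y))) 2
      (volume.restrict Ω) ^ 2 ≤ smoothSobolevNormSq k Ω fun x => φ (c • x + -(c • y)) := by
    unfold smoothSobolevNormSq
    refine le_trans ?_ (Finset.single_le_sum (f := fun j => ∑ α ∈ multiIdx N j,
      eLpNorm (multiDeriv α fun x => φ (c • x + -(c • y))) 2 (volume.restrict Ω) ^ 2)
      (fun _ _ => zero_le) (Finset.self_mem_range_succ k))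
    exact Finset.single_le_sum (f := fun α =>
      eLpNorm (multiDeriv α fun x => φ (c • x + -(c • y))) 2 (volume.restrict Ω) ^ 2)
      (fun _ _ => zero_le) (Finset.mem_piAntidiag.2 ⟨by simp, fun _ _ => Finset.mem_univ _⟩)
  have h3 := h2.trans h1
  rw [ht.eLpNorm_sq, (ht.applyOp k A).eLpNorm_sq, (ht.multiDeriv _).eLpNorm_sq,
    ← ENNReal.ofReal_add (by positivity) (by positivity), ← ENNReal.ofReal_coe_nnreal,
    ← ENNReal.ofReal_mul (by positivity), ENNReal.ofReal_le_ofReal_iff (by positivity),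
    applyOp_comp_smul_add k A c _ hφ.1, multiDeriv_comp_smul_add _ c _ hφ.1,
    Finset.sum_pi_single' i k] at h3
  simp only [norm_smul, mul_pow, Finset.mem_univ, if_true, integral_const_mul] at h3
  rw [integral_comp_smul_add (fun x => ‖φ x‖ ^ 2) hc0,
    integral_comp_smul_add (fun x => ‖applyOp k A φ x‖ ^ 2) hc0,
    integral_comp_smul_add (fun x => ‖multiDeriv (Pi.single i k) φ x‖ ^ 2) hc0,
    multiDeriv_single] at h3
  have h4 := integral_norm_sq_le_iterate_partialDeriv i k hφR
  rw [← hP] at h4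
  set a := ∫ x, ‖(partialDeriv i)^[k] φ x‖ ^ 2
  set b := ∫ x, ‖φ x‖ ^ 2
  set g := ∫ x, ‖applyOp k A φ x‖ ^ 2 with hg
  have ha : 0 ≤ a := integral_nonneg fun _ => by positivity
  have hg0 : 0 ≤ g := integral_nonneg fun _ => by positivity
  have hck : (‖c ^ k‖ ^ 2 : ℝ) = c ^ (2 * k) := by
    rw [Real.norm_eq_abs, sq_abs, ← pow_mul, mul_comm]
  rw [hck] at h3
  have hcN : 0 < (c ^ N)⁻¹ := by positivity
  have h5 : c ^ (2 * k) * a ≤ C * (b + c ^ (2 * k) * g) := by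
    refine le_of_mul_le_mul_left ?_ hcN
    calc (c ^ N)⁻¹ * (c ^ (2 * k) * a) = c ^ (2 * k) * ((c ^ N)⁻¹ * a) := by ring
      _ ≤ _ := h3
      _ = _ := by ring
  have hq : 0 < c ^ (2 * k) := by positivity
  -- Here C b ≤ C P a ≤ c^{2k} a / 2, so the L² term moves to the left side.
  have h6 : a ≤ 2 * C * g := by
    refine le_of_mul_le_mul_left ?_ hq
    have h7 : (C : ℝ) * b ≤ C * (P * a) := mul_le_mul_of_nonneg_left h4 C.2
    have h8 := mul_le_mul_of_nonneg_right hcP ha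
    nlinarith
  nlinarith [mul_le_mul_of_nonneg_left h6 hP0.le]

end Poincare

/-! ### Lax–Milgram on a closed graph -/

section Hilbert

variable {X Y : Type*} [NormedAddCommGroup X] [InnerProductSpace ℝ X] [CompleteSpace X]
  [NormedAddCommGroup Y] [InnerProductSpace ℝ Y] [CompleteSpace Y]

/-- The Lax–Milgram theorem on the graph `G` of a closed operator that is bounded below. -/
theorem exists_mem_forall_inner_eq (G : Submodule ℝ (WithLp 2 (X × Y)))
    (hG : IsClosed (G : Set (WithLp 2 (X × Y)))) {C : ℝ} (hC : 0 < C)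
    (hGC : ∀ p ∈ G, ‖p.fst‖ ^ 2 ≤ C * ‖p.snd‖ ^ 2) (S : Y →L[ℝ] Y) {m : ℝ} (hm : 0 < m)
    (hS : ∀ y, m * ‖y‖ ^ 2 ≤ inner ℝ (S y) y) (f : X) :
    ∃ p ∈ G, ∀ q ∈ G, (inner ℝ (S p.snd) q.snd : ℝ) = inner ℝ f q.fst := by
  have : CompleteSpace G := hG.completeSpace_coe
  let fst' : G →L[ℝ] X := (WithLp.fstL 2 ℝ X Y).comp G.subtypeL
  let snd' : G →L[ℝ] Y := (WithLp.sndL 2 ℝ X Y).comp G.subtypeL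
  let B : G →L[ℝ] G →L[ℝ] ℝ := (innerSL ℝ).bilinearComp (S.comp snd') snd'
  have hB : ∀ p q : G, B p q = inner ℝ (S p.1.snd) q.1.snd := fun _ _ => rfl
  have hcoer : IsCoercive B := by
    -- On the graph, ‖p‖² = ‖p.fst‖² + ‖p.snd‖² ≤ (1 + C) ‖p.snd‖².
    refine ⟨m / (1 + C), by positivity, fun p => ?_⟩
    have h1 : ‖p‖ ^ 2 = ‖p.1.fst‖ ^ 2 + ‖p.1.snd‖ ^ 2 := WithLp.prod_norm_sq_eq_of_L2 p.1
    have h2 := hGC p.1 p.2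
    rw [hB, mul_assoc, ← sq, div_mul_eq_mul_div, div_le_iff₀ (by positivity)]
    have h3 := hS p.1.snd
    nlinarith
  let F : G →L[ℝ] ℝ := (innerSL ℝ f).comp fst'
  let p : G := hcoer.continuousLinearEquivOfBilin.symm ((InnerProductSpace.toDual ℝ G).symm F)
  refine ⟨p.1, p.2, fun q hq => ?_⟩
  have h1 := hcoer.continuousLinearEquivOfBilin_apply p ⟨q, hq⟩
  rw [ContinuousLinearEquiv.apply_symm_apply, InnerProductSpace.toDual_symm_apply] at h1
  exact h1.symm

end Hilbert

/-! ### The weak operator and W_0^𝒜 as a closed graph -/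

section WeakOperators

variable {N : ℕ} {V W : Type} [NormedAddCommGroup V] [InnerProductSpace ℝ V]
  [FiniteDimensional ℝ V] [NormedAddCommGroup W] [InnerProductSpace ℝ W] [FiniteDimensional ℝ W]

/-- The class of a test function in `L²(Ω; V)`. -/
def IsTest.toL2 {Ω : Set (Sp N)} {φ : Sp N → V} (h : IsTest Ω φ) : L2 Ω V :=
  (h.memLp (volume.restrict Ω)).toLp φ

theorem IsTest.coeFn_toL2 {Ω : Set (Sp N)} {φ : Sp N → V} (h : IsTest Ω φ) :
    h.toL2 =ᵐ[volume.restrict Ω] φ :=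
  MemLp.coeFn_toLp _

theorem IsTest.toL2_congr {Ω : Set (Sp N)} {φ ψ : Sp N → V} (h : IsTest Ω φ) (h' : IsTest Ω ψ)
    (e : φ = ψ) : h.toL2 = h'.toL2 := by
  subst e
  rfl

theorem IsTest.inner_toL2 {Ω : Set (Sp N)} {φ : Sp N → V} (h : IsTest Ω φ) (u : L2 Ω V) :
    (inner ℝ u h.toL2 : ℝ) = ∫ x in Ω, inner ℝ (u x) (φ x) := by
  rw [L2.inner_def]
  refine integral_congr_ae ?_
  filter_upwards [h.coeFn_toL2] with x hx
  rw [hx]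

theorem hasWeakOp_iff {k : ℕ} {A : Coeffs N V W} {Ω : Set (Sp N)} {u : L2 Ω V} {g : L2 Ω W} :
    HasWeakOp k A Ω u g ↔ ∀ (ψ : Sp N → W) (h : IsTest Ω ψ),
      (inner ℝ u (h.applyAdj k A).toL2 : ℝ) = inner ℝ g h.toL2 := by
  simp only [IsTest.inner_toL2]
  rfl

/-- This is the fundamental lemma of the calculus of variations, applied to scalar bumps times
constant vectors. It makes the choice in `weakOp` harmless. -/
theorem HasWeakOp.unique {k : ℕ} {A : Coeffs N V W} {Ω : Set (Sp N)} (hΩ : IsOpen Ω)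
    {u : L2 Ω V} {g g' : L2 Ω W} (h : HasWeakOp k A Ω u g) (h' : HasWeakOp k A Ω u g') :
    g = g' := by
  rw [← sub_eq_zero]
  have h1 : ∀ (ψ : Sp N → W) (_ : IsTest Ω ψ), ∫ x in Ω, inner ℝ ((g - g' : L2 Ω W) x) (ψ x) = 0 := by
    intro ψ hψ
    rw [← hψ.inner_toL2, inner_sub_left, ← hasWeakOp_iff.1 h ψ hψ, ← hasWeakOp_iff.1 h' ψ hψ,
      sub_self]
  generalize g - g' = d at h1
  have hloc : LocallyIntegrableOn d Ω volume :=
    locallyIntegrableOn_of_locallyIntegrable_restrict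
      ((Lp.memLp d).locallyIntegrable one_le_two)
  have h2 := hΩ.ae_eq_zero_of_integral_contDiff_smul_eq_zero hloc fun η hη hηc hηΩ => by
    have e : ∫ x, η x • d x = ∫ x in Ω, η x • d x := by
      refine (setIntegral_eq_integral_of_forall_compl_eq_zero fun x hx => ?_).symm
      rw [image_eq_zero_of_notMem_tsupport fun h => hx (hηΩ h), zero_smul]
    have hInt : Integrable (fun x => η x • d x) (volume.restrict Ω) :=
      ((Lp.memLp d).locallyIntegrable one_le_two).integrable_smul_left_of_hasCompactSupport
        hη.continuous hηc
    rw [e]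
    refine ext_inner_right ℝ fun w => ?_
    have hψ : IsTest Ω fun x => η x • w := by
      have hs : tsupport (fun x => η x • w) ⊆ tsupport η :=
        closure_mono fun x hx hx' => hx (by simp [hx'])
      exact ⟨hη.smul contDiff_const, hηc.of_isClosed_subset (isClosed_tsupport _) hs,
        hs.trans hηΩ⟩
    rw [inner_zero_left, real_inner_comm, ← integral_inner hInt, ← h1 _ hψ]
    refine integral_congr_ae (Eventually.of_forall fun x => ?_)
    simp only [real_inner_smul_right, real_inner_smul_left, real_inner_comm]
  refine Lp.ext ?_
  rw [← ae_restrict_iff' hΩ.measurableSet] at h2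
  filter_upwards [h2, Lp.coeFn_zero W 2 (volume.restrict Ω)] with x hx hx'
  rw [hx, hx', Pi.zero_apply]

theorem weakOp_eq {k : ℕ} {A : Coeffs N V W} {Ω : Set (Sp N)} (hΩ : IsOpen Ω) {u : L2 Ω V}
    {g : L2 Ω W} (h : HasWeakOp k A Ω u g) : weakOp k A Ω u = g := by
  have hex : ∃ g, HasWeakOp k A Ω u g := ⟨g, h⟩
  rw [weakOp, dif_pos hex]
  exact hex.choose_spec.unique hΩ h

theorem IsTest.hasWeakOp {k : ℕ} {A : Coeffs N V W} {Ω : Set (Sp N)} {φ : Sp N → V}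
    (h : IsTest Ω φ) : HasWeakOp k A Ω h.toL2 (h.applyOp k A).toL2 := by
  intro ψ hψ
  have e1 : ∫ x in Ω, inner ℝ (h.toL2 x) (OptimalDesign.applyAdj k A ψ x) =
      ∫ x in Ω, inner ℝ (φ x) (OptimalDesign.applyAdj k A ψ x) := by
    refine integral_congr_ae ?_
    filter_upwards [h.coeFn_toL2] with x hx
    rw [hx]
  have e2 : ∫ x in Ω, inner ℝ ((h.applyOp k A).toL2 x) (ψ x) =
      ∫ x in Ω, inner ℝ (OptimalDesign.applyOp k A φ x) (ψ x) := by
    refine integral_congr_ae ?_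
    filter_upwards [(h.applyOp k A).coeFn_toL2] with x hx
    rw [hx]
  rw [e1, e2, h.setIntegral_eq _ fun x hx => by rw [hx, inner_zero_left],
    (h.applyOp k A).setIntegral_eq _ fun x hx => by rw [hx, inner_zero_left]]
  exact integral_inner_applyAdj k A (h.mono (subset_univ _)) (hψ.mono (subset_univ _))

/-- The graph of `𝒜` on test functions. -/
def testGraph (k : ℕ) (A : Coeffs N V W) (Ω : Set (Sp N)) :
    Submodule ℝ (WithLp 2 (L2 Ω V × L2 Ω W)) where
  carrier := {p | ∃ (φ : Sp N → V) (h : IsTest Ω φ),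
    p = WithLp.toLp 2 (h.toL2, (h.applyOp k A).toL2)}
  zero_mem' := by
    have e : applyOp k A (0 : Sp N → V) = 0 := by
      have := applyOp_const_smul k A 0 (contDiff_const (c := (0 : V)) : ContDiff ℝ ∞ (0 : Sp N → V))
      simpa using this
    refine ⟨0, isTest_zero Ω, ?_⟩
    rw [((isTest_zero Ω).applyOp k A).toL2_congr (isTest_zero Ω) e]
    rfl
  add_mem' := by
    rintro _ _ ⟨φ, hφ, rfl⟩ ⟨ψ, hψ, rfl⟩
    refine ⟨φ + ψ, hφ.add hψ, ?_⟩
    rw [((hφ.add hψ).applyOp k A).toL2_congr ((hφ.applyOp k A).add (hψ.applyOp k A))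
      (applyOp_add k A hφ.1 hψ.1)]
    rfl
  smul_mem' := by
    rintro c _ ⟨φ, hφ, rfl⟩
    refine ⟨c • φ, hφ.const_smul c, ?_⟩
    rw [((hφ.const_smul c).applyOp k A).toL2_congr ((hφ.applyOp k A).const_smul c)
      (applyOp_const_smul k A c hφ.1)]
    rfl

/-- The graph of the closure of `𝒜` on test functions. -/
def opGraph (k : ℕ) (A : Coeffs N V W) (Ω : Set (Sp N)) :
    Submodule ℝ (WithLp 2 (L2 Ω V × L2 Ω W)) :=
  (testGraph k A Ω).topologicalClosure

/-- The weak relation is tested against fixed L² functions, hence is closed in the product; so 𝒜 on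
test functions is closable. -/
theorem hasWeakOp_of_mem_opGraph {k : ℕ} {A : Coeffs N V W} {Ω : Set (Sp N)}
    {p : WithLp 2 (L2 Ω V × L2 Ω W)} (h : p ∈ opGraph k A Ω) :
    HasWeakOp k A Ω p.fst p.snd := by
  have hcl : IsClosed {p : WithLp 2 (L2 Ω V × L2 Ω W) | HasWeakOp k A Ω p.fst p.snd} := by
    simp only [hasWeakOp_iff, Set.ofPred_forall]
    refine isClosed_iInter fun ψ => isClosed_iInter fun hψ => isClosed_eq ?_ ?_
    · exact (WithLp.fstL 2 ℝ _ _).continuous.inner continuous_const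
    · exact (WithLp.sndL 2 ℝ _ _).continuous.inner continuous_const
  refine closure_minimal ?_ hcl h
  rintro _ ⟨φ, hφ, rfl⟩
  exact hφ.hasWeakOp

theorem eLpNorm_sub_eq_toL2 {Ω : Set (Sp N)} {φ : Sp N → V} (h : IsTest Ω φ) (u : L2 Ω V) :
    eLpNorm (fun x => u x - φ x) 2 (volume.restrict Ω) ^ 2 =
      ENNReal.ofReal (‖u - h.toL2‖ ^ 2) := by
  rw [ENNReal.ofReal_pow (norm_nonneg _), ofReal_norm, Lp.enorm_def]
  congr 1
  refine eLpNorm_congr_ae ?_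
  filter_upwards [Lp.coeFn_sub u h.toL2, h.coeFn_toL2] with x h1 h2
  rw [h1, Pi.sub_apply, h2]

/-- The W^𝒜 norm of u − φ is the distance between the corresponding graph points in the ℓ² product.
Hence W_0^𝒜 is handled as a closed subspace of a Hilbert space. -/
theorem mem_WA0_iff {k : ℕ} {A : Coeffs N V W} {Ω : Set (Sp N)} (hΩ : IsOpen Ω) {u : L2 Ω V} :
    u ∈ WA0 k A Ω ↔ ∃ g, WithLp.toLp 2 (u, g) ∈ opGraph k A Ω := by
  have key : ∀ (g : L2 Ω W) (φ : Sp N → V) (h : IsTest Ω φ),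
      eLpNorm (fun x => u x - φ x) 2 (volume.restrict Ω) ^ 2 +
        eLpNorm (fun x => g x - applyOp k A φ x) 2 (volume.restrict Ω) ^ 2 =
      ENNReal.ofReal (‖WithLp.toLp 2 (u, g) -
        WithLp.toLp 2 (h.toL2, (h.applyOp k A).toL2)‖ ^ 2) := by
    intro g φ h
    rw [eLpNorm_sub_eq_toL2 h, eLpNorm_sub_eq_toL2 (h.applyOp k A), WithLp.prod_norm_sq_eq_of_L2,
      ENNReal.ofReal_add (by positivity) (by positivity)]
    rfl
  constructor
  · rintro ⟨_, hu⟩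
    refine ⟨weakOp k A Ω u, Metric.mem_closure_iff.2 fun ε hε => ?_⟩
    obtain ⟨φ, hφ, hlt⟩ := hu (ENNReal.ofReal (ε ^ 2)) (by simp; positivity)
    rw [key _ _ hφ, ENNReal.ofReal_lt_ofReal_iff (by positivity)] at hlt
    refine ⟨_, ⟨φ, hφ, rfl⟩, ?_⟩
    rw [dist_eq_norm]
    exact lt_of_pow_lt_pow_left₀ 2 hε.le hlt
  · rintro ⟨g, hg⟩
    have hw : HasWeakOp k A Ω u g := hasWeakOp_of_mem_opGraph hg
    refine ⟨⟨g, hw⟩, fun ε hε => ?_⟩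
    rw [weakOp_eq hΩ hw]
    obtain ⟨δ, hδ, hδε⟩ : ∃ δ : ℝ, 0 < δ ∧ ENNReal.ofReal (δ ^ 2) ≤ ε := by
      rcases eq_or_ne ε ⊤ with rfl | hε'
      · exact ⟨1, one_pos, le_top⟩
      · refine ⟨√ε.toReal, Real.sqrt_pos.2 (ENNReal.toReal_pos hε.ne' hε'), ?_⟩
        rw [Real.sq_sqrt ENNReal.toReal_nonneg, ENNReal.ofReal_toReal hε']
    obtain ⟨_, ⟨φ, hφ, rfl⟩, hd⟩ := Metric.mem_closure_iff.1 hg δ hδ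
    refine ⟨φ, hφ, lt_of_lt_of_le ?_ hδε⟩
    rw [key _ _ hφ, ENNReal.ofReal_lt_ofReal_iff (by positivity)]
    rw [dist_eq_norm] at hd
    exact pow_lt_pow_left₀ hd (norm_nonneg _) two_ne_zero

theorem toLp_weakOp_mem_opGraph {k : ℕ} {A : Coeffs N V W} {Ω : Set (Sp N)} (hΩ : IsOpen Ω)
    {u : L2 Ω V} (h : u ∈ WA0 k A Ω) :
    WithLp.toLp 2 (u, weakOp k A Ω u) ∈ opGraph k A Ω := by
  obtain ⟨g, hg⟩ := (mem_WA0_iff hΩ).1 h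
  have hw : HasWeakOp k A Ω u g := hasWeakOp_of_mem_opGraph hg
  rwa [weakOp_eq hΩ hw]

theorem sub_mem_opGraph {k : ℕ} {A : Coeffs N V W} {Ω : Set (Sp N)} {u u' : L2 Ω V}
    {g g' : L2 Ω W} (h : WithLp.toLp 2 (u, g) ∈ opGraph k A Ω)
    (h' : WithLp.toLp 2 (u', g') ∈ opGraph k A Ω) :
    WithLp.toLp 2 (u - u', g - g') ∈ opGraph k A Ω :=
  Submodule.sub_mem _ h h'

theorem IsTest.norm_toL2_sq {Ω : Set (Sp N)} {φ : Sp N → V} (h : IsTest Ω φ) :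
    ‖h.toL2‖ ^ 2 = ∫ x, ‖φ x‖ ^ 2 := by
  rw [← real_inner_self_eq_norm_sq, h.inner_toL2,
    ← h.setIntegral_eq (fun x => ‖φ x‖ ^ 2) fun x hx => by simp [hx]]
  refine integral_congr_ae ?_
  filter_upwards [h.coeFn_toL2] with x hx
  rw [hx, real_inner_self_eq_norm_sq]

/-- The Poincaré inequality is a closed condition on graph points, so it passes from test functions
to the closure. -/
theorem norm_fst_sq_le_of_mem_opGraph {k : ℕ} {A : Coeffs N V W} {Ω : Set (Sp N)} {C : ℝ}
    (hC : ∀ φ : Sp N → V, IsTest Ω φ → ∫ x, ‖φ x‖ ^ 2 ≤ C * ∫ x, ‖applyOp k A φ x‖ ^ 2)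
    {p : WithLp 2 (L2 Ω V × L2 Ω W)} (h : p ∈ opGraph k A Ω) :
    ‖p.fst‖ ^ 2 ≤ C * ‖p.snd‖ ^ 2 := by
  have hcl : IsClosed {p : WithLp 2 (L2 Ω V × L2 Ω W) | ‖p.fst‖ ^ 2 ≤ C * ‖p.snd‖ ^ 2} :=
    isClosed_le ((WithLp.fstL 2 ℝ _ _).continuous.norm.pow 2)
      (continuous_const.mul ((WithLp.sndL 2 ℝ _ _).continuous.norm.pow 2))
  refine closure_minimal ?_ hcl h
  rintro _ ⟨φ, hφ, rfl⟩
  change ‖hφ.toL2‖ ^ 2 ≤ C * ‖(hφ.applyOp k A).toL2‖ ^ 2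
  rw [hφ.norm_toL2_sq, (hφ.applyOp k A).norm_toL2_sq]
  exact hC φ hφ

theorem norm_sq_le_of_mem_opGraph {k : ℕ} {A : Coeffs N V W} {Ω : Set (Sp N)} {C : ℝ}
    (hC : ∀ φ : Sp N → V, IsTest Ω φ → ∫ x, ‖φ x‖ ^ 2 ≤ C * ∫ x, ‖applyOp k A φ x‖ ^ 2)
    {u : L2 Ω V} {g : L2 Ω W} (h : WithLp.toLp 2 (u, g) ∈ opGraph k A Ω) :
    ‖u‖ ^ 2 ≤ C * ‖g‖ ^ 2 :=
  norm_fst_sq_le_of_mem_opGraph (p := WithLp.toLp 2 (u, g)) hC h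

end WeakOperators

/-! ### State equation and bulk energy -/

section States

variable {N d k : ℕ} {Ω : Set (Sp N)}

theorem sigma_of_mem {σ₁ σ₂ : Arr d N k →ₗ[ℝ] Arr d N k} {A : Set (Sp N)} {x : Sp N}
    (hx : x ∈ A) : sigma Ω σ₁ σ₂ A x = σ₁ := by
  simp [sigma, hx]

theorem sigma_of_notMem {σ₁ σ₂ : Arr d N k →ₗ[ℝ] Arr d N k} {A : Set (Sp N)} {x : Sp N}
    (hxΩ : x ∈ Ω) (hx : x ∉ A) : sigma Ω σ₁ σ₂ A x = σ₂ := by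
  simp [sigma, hx, hxΩ]

theorem exists_norm_sigma_le (Ω : Set (Sp N)) (σ₁ σ₂ : Arr d N k →ₗ[ℝ] Arr d N k) :
    ∃ K : ℝ, 0 ≤ K ∧ ∀ (A : Set (Sp N)) (x : Sp N) (P : Arr d N k),
      ‖sigma Ω σ₁ σ₂ A x P‖ ≤ K * ‖P‖ := by
  refine ⟨‖LinearMap.toContinuousLinearMap σ₁‖ + ‖LinearMap.toContinuousLinearMap σ₂‖,
    by positivity, fun A x P => ?_⟩
  have h1 : ‖σ₁ P‖ ≤ ‖LinearMap.toContinuousLinearMap σ₁‖ * ‖P‖ :=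
    (LinearMap.toContinuousLinearMap σ₁).le_opNorm P
  have h2 : ‖σ₂ P‖ ≤ ‖LinearMap.toContinuousLinearMap σ₂‖ * ‖P‖ :=
    (LinearMap.toContinuousLinearMap σ₂).le_opNorm P
  rw [add_mul]
  unfold sigma
  rw [LinearMap.add_apply]
  refine (norm_add_le _ _).trans (add_le_add ?_ ?_)
  · by_cases h : x ∈ A
    · simpa [h] using h1
    · simp [h]
      positivity
  · by_cases h : x ∈ Ω \ A
    · simpa only [indicator_of_mem h] using h2
    · simp only [indicator_of_notMem h, LinearMap.zero_apply, norm_zero]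
      positivity

theorem memLp_sigma (hΩ : MeasurableSet Ω) (σ₁ σ₂ : Arr d N k →ₗ[ℝ] Arr d N k) {A : Set (Sp N)}
    (hA : MeasurableSet A) (g : L2 Ω (Arr d N k)) :
    MemLp (fun x => sigma Ω σ₁ σ₂ A x (g x)) 2 (volume.restrict Ω) := by
  have e : (fun x => sigma Ω σ₁ σ₂ A x (g x)) =
      A.indicator (fun x => LinearMap.toContinuousLinearMap σ₁ (g x)) +
        (Ω \ A).indicator fun x => LinearMap.toContinuousLinearMap σ₂ (g x) := by
    ext1 x
    unfold sigma
    rw [LinearMap.add_apply, Pi.add_apply]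
    congr 1
    · by_cases h : x ∈ A <;> simp [h]
    · by_cases h : x ∈ Ω \ A
      · simp only [indicator_of_mem h]
        rfl
      · simp only [indicator_of_notMem h, LinearMap.zero_apply]
  rw [e]
  exact (((LinearMap.toContinuousLinearMap σ₁).comp_memLp' (Lp.memLp g)).indicator hA).add
    (((LinearMap.toContinuousLinearMap σ₂).comp_memLp' (Lp.memLp g)).indicator (hΩ.diff hA))

theorem toLp_sigma_add (hΩ : MeasurableSet Ω) (σ₁ σ₂ : Arr d N k →ₗ[ℝ] Arr d N k)
    {A : Set (Sp N)} (hA : MeasurableSet A) (g g' : L2 Ω (Arr d N k)) :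
    (memLp_sigma hΩ σ₁ σ₂ hA (g + g')).toLp =
      (memLp_sigma hΩ σ₁ σ₂ hA g).toLp + (memLp_sigma hΩ σ₁ σ₂ hA g').toLp := by
  rw [← MemLp.toLp_add]
  refine MemLp.toLp_congr _ _ ?_
  filter_upwards [Lp.coeFn_add g g'] with x hx
  rw [hx, Pi.add_apply, Pi.add_apply, map_add]

theorem toLp_sigma_smul (hΩ : MeasurableSet Ω) (σ₁ σ₂ : Arr d N k →ₗ[ℝ] Arr d N k)
    {A : Set (Sp N)} (hA : MeasurableSet A) (c : ℝ) (g : L2 Ω (Arr d N k)) :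
    (memLp_sigma hΩ σ₁ σ₂ hA (c • g)).toLp = c • (memLp_sigma hΩ σ₁ σ₂ hA g).toLp := by
  rw [← MemLp.toLp_const_smul]
  refine MemLp.toLp_congr _ _ ?_
  filter_upwards [Lp.coeFn_smul c g] with x hx
  rw [hx, Pi.smul_apply, Pi.smul_apply, map_smul]

theorem norm_toLp_sigma_le (hΩ : MeasurableSet Ω) (σ₁ σ₂ : Arr d N k →ₗ[ℝ] Arr d N k)
    {A : Set (Sp N)} (hA : MeasurableSet A) {K : ℝ}
    (hK : ∀ (A : Set (Sp N)) (x : Sp N) (P : Arr d N k), ‖sigma Ω σ₁ σ₂ A x P‖ ≤ K * ‖P‖)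
    (g : L2 Ω (Arr d N k)) : ‖(memLp_sigma hΩ σ₁ σ₂ hA g).toLp‖ ≤ K * ‖g‖ := by
  refine Lp.norm_le_mul_norm_of_ae_le_mul ?_
  filter_upwards [(memLp_sigma hΩ σ₁ σ₂ hA g).coeFn_toLp] with x hx
  rw [hx]
  exact hK A x (g x)

/-- Multiplication by `σ_A` on `L²(Ω)`. -/
def sigmaL2 (hΩ : MeasurableSet Ω) (σ₁ σ₂ : Arr d N k →ₗ[ℝ] Arr d N k) {A : Set (Sp N)}
    (hA : MeasurableSet A) : L2 Ω (Arr d N k) →L[ℝ] L2 Ω (Arr d N k) :=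
  LinearMap.mkContinuous
    { toFun := fun g => (memLp_sigma hΩ σ₁ σ₂ hA g).toLp
      map_add' := toLp_sigma_add hΩ σ₁ σ₂ hA
      map_smul' := toLp_sigma_smul hΩ σ₁ σ₂ hA }
    (exists_norm_sigma_le Ω σ₁ σ₂).choose
    (norm_toLp_sigma_le hΩ σ₁ σ₂ hA (exists_norm_sigma_le Ω σ₁ σ₂).choose_spec.2)

theorem coeFn_sigmaL2 (hΩ : MeasurableSet Ω) (σ₁ σ₂ : Arr d N k →ₗ[ℝ] Arr d N k) {A : Set (Sp N)}
    (hA : MeasurableSet A) (g : L2 Ω (Arr d N k)) :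
    sigmaL2 hΩ σ₁ σ₂ hA g =ᵐ[volume.restrict Ω] fun x => sigma Ω σ₁ σ₂ A x (g x) :=
  (memLp_sigma hΩ σ₁ σ₂ hA g).coeFn_toLp

theorem inner_sigmaL2 (hΩ : MeasurableSet Ω) (σ₁ σ₂ : Arr d N k →ₗ[ℝ] Arr d N k) {A : Set (Sp N)}
    (hA : MeasurableSet A) (g h : L2 Ω (Arr d N k)) :
    (inner ℝ (sigmaL2 hΩ σ₁ σ₂ hA g) h : ℝ) =
      ∫ x in Ω, inner ℝ (sigma Ω σ₁ σ₂ A x (g x)) (h x) := by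
  rw [L2.inner_def]
  refine integral_congr_ae ?_
  filter_upwards [coeFn_sigmaL2 hΩ σ₁ σ₂ hA g] with x hx
  rw [hx]

theorem inner_sigmaL2_comm (hΩ : MeasurableSet Ω) {σ₁ σ₂ : Arr d N k →ₗ[ℝ] Arr d N k}
    (hσ₁ : σ₁.IsSymmetric) (hσ₂ : σ₂.IsSymmetric) {A : Set (Sp N)}
    (hA : MeasurableSet A) (g h : L2 Ω (Arr d N k)) :
    (inner ℝ (sigmaL2 hΩ σ₁ σ₂ hA g) h : ℝ) = inner ℝ (sigmaL2 hΩ σ₁ σ₂ hA h) g := by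
  rw [inner_sigmaL2, inner_sigmaL2]
  refine integral_congr_ae ?_
  filter_upwards [ae_restrict_mem hΩ] with x hx
  by_cases h : x ∈ A
  · rw [sigma_of_mem h, hσ₁, real_inner_comm]
  · rw [sigma_of_notMem hx h, hσ₂, real_inner_comm]

theorem le_inner_sigmaL2 (hΩ : MeasurableSet Ω) {σ₁ σ₂ : Arr d N k →ₗ[ℝ] Arr d N k} {m : ℝ}
    (hσ₁ : ∀ P, m * ‖P‖ ^ 2 ≤ inner ℝ (σ₁ P) P) (hσ₂ : ∀ P, m * ‖P‖ ^ 2 ≤ inner ℝ (σ₂ P) P)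
    {A : Set (Sp N)} (hA : MeasurableSet A) (g : L2 Ω (Arr d N k)) :
    m * ‖g‖ ^ 2 ≤ inner ℝ (sigmaL2 hΩ σ₁ σ₂ hA g) g := by
  rw [← real_inner_self_eq_norm_sq, L2.inner_def, L2.inner_def, ← integral_const_mul]
  refine integral_mono_ae ((L2.integrable_inner g g).const_mul m)
    (L2.integrable_inner (sigmaL2 hΩ σ₁ σ₂ hA g) g) ?_
  filter_upwards [ae_restrict_mem hΩ, coeFn_sigmaL2 hΩ σ₁ σ₂ hA g] with x hx hg
  simp only [hg, real_inner_self_eq_norm_sq]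
  by_cases h : x ∈ A
  · rw [sigma_of_mem h]
    exact hσ₁ _
  · rw [sigma_of_notMem hx h]
    exact hσ₂ _

variable {op : Coeffs N (Sp d) (Arr d N k)} {σ₁ σ₂ : Arr d N k →ₗ[ℝ] Arr d N k}
  {f : Linf Ω (Sp d)} {A : Set (Sp N)}

theorem exists_L2_eq_Linf (hΩb : Bornology.IsBounded Ω) (f : Linf Ω (Sp d)) :
    ∃ f' : L2 Ω (Sp d), f' =ᵐ[volume.restrict Ω] f := by
  have : IsFiniteMeasure (volume.restrict Ω) := ⟨by simpa using hΩb.measure_lt_top⟩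
  have h : MemLp f 2 (volume.restrict Ω) := (Lp.memLp f).mono_exponent le_top
  exact ⟨h.toLp, h.coeFn_toLp⟩

/-- Both sides of the equation are continuous in the graph point, so test functions may be replaced
by all of W_0^𝒜. In particular the state itself becomes an allowed test function. -/
theorem isState_iff (hΩo : IsOpen Ω) (hA : MeasurableSet A) {f' : L2 Ω (Sp d)}
    (hf : f' =ᵐ[volume.restrict Ω] f) {u : L2 Ω (Sp d)} :
    IsState Ω op σ₁ σ₂ f A u ↔ u ∈ WA0 k op Ω ∧ ∀ q ∈ opGraph k op Ω,
      (inner ℝ (sigmaL2 hΩo.measurableSet σ₁ σ₂ hA (weakOp k op Ω u)) q.snd : ℝ) =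
        inner ℝ f' q.fst := by
  have key : ∀ (φ : Sp N → Sp d) (hφ : IsTest Ω φ),
      (∫ x in Ω, inner ℝ (sigma Ω σ₁ σ₂ A x (weakOp k op Ω u x)) (applyOp k op φ x) =
        ∫ x in Ω, inner ℝ (f x) (φ x)) ↔
      (inner ℝ (sigmaL2 hΩo.measurableSet σ₁ σ₂ hA (weakOp k op Ω u)) (hφ.applyOp k op).toL2 : ℝ) =
        inner ℝ f' hφ.toL2 := by
    intro φ hφ
    have e1 : ∫ x in Ω, inner ℝ (sigma Ω σ₁ σ₂ A x (weakOp k op Ω u x)) (applyOp k op φ x) =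
        inner ℝ (sigmaL2 hΩo.measurableSet σ₁ σ₂ hA (weakOp k op Ω u))
          (hφ.applyOp k op).toL2 := by
      rw [(hφ.applyOp k op).inner_toL2]
      refine integral_congr_ae ?_
      filter_upwards [coeFn_sigmaL2 hΩo.measurableSet σ₁ σ₂ hA (weakOp k op Ω u)] with x hx
      rw [hx]
    have e2 : ∫ x in Ω, inner ℝ (f x) (φ x) = inner ℝ f' hφ.toL2 := by
      rw [hφ.inner_toL2]
      refine integral_congr_ae ?_
      filter_upwards [hf] with x hx
      rw [hx]
    rw [e1, e2]
  refine and_congr_right fun _ => ⟨fun h => ?_, fun h φ hφ => (key φ hφ).2 ?_⟩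
  · have hcl : IsClosed {q : WithLp 2 (L2 Ω (Sp d) × L2 Ω (Arr d N k)) |
        (inner ℝ (sigmaL2 hΩo.measurableSet σ₁ σ₂ hA (weakOp k op Ω u)) q.snd : ℝ) =
          inner ℝ f' q.fst} :=
      isClosed_eq (continuous_const.inner (WithLp.sndL 2 ℝ _ _).continuous)
        (continuous_const.inner (WithLp.fstL 2 ℝ _ _).continuous)
    intro q hq
    refine closure_minimal ?_ hcl hq
    rintro _ ⟨φ, hφ, rfl⟩
    exact (key φ hφ).1 (h φ hφ)
  · exact h (WithLp.toLp 2 (hφ.toL2, (hφ.applyOp k op).toL2)) (subset_closure ⟨φ, hφ, rfl⟩)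

theorem exists_isState (hΩo : IsOpen Ω) (hΩb : Bornology.IsBounded Ω)
    {C : ℝ} (hC0 : 0 < C)
    (hC : ∀ φ : Sp N → Sp d, IsTest Ω φ → ∫ x, ‖φ x‖ ^ 2 ≤ C * ∫ x, ‖applyOp k op φ x‖ ^ 2)
    {m : ℝ} (hm : 0 < m) (hσ₁ : ∀ P, m * ‖P‖ ^ 2 ≤ inner ℝ (σ₁ P) P)
    (hσ₂ : ∀ P, m * ‖P‖ ^ 2 ≤ inner ℝ (σ₂ P) P) (hA : MeasurableSet A) :
    ∃ w, IsState Ω op σ₁ σ₂ f A w := by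
  obtain ⟨f', hf⟩ := exists_L2_eq_Linf hΩb f
  obtain ⟨p, hp, h⟩ := exists_mem_forall_inner_eq (opGraph k op Ω)
    (Submodule.isClosed_topologicalClosure _) hC0
    (fun p hp => norm_fst_sq_le_of_mem_opGraph hC hp)
    (sigmaL2 hΩo.measurableSet σ₁ σ₂ hA) hm (le_inner_sigmaL2 hΩo.measurableSet hσ₁ hσ₂ hA) f'
  refine ⟨p.fst, (isState_iff hΩo hA hf).2 ⟨(mem_WA0_iff hΩo).2 ⟨p.snd, hp⟩, ?_⟩⟩
  rw [weakOp_eq hΩo (hasWeakOp_of_mem_opGraph hp)]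
  exact h

/-- The part of `I_Ω(u, A)` without the perimeter. -/
def bulkEnergy (Ω : Set (Sp N)) (op : Coeffs N (Sp d) (Arr d N k))
    (σ₁ σ₂ : Arr d N k →ₗ[ℝ] Arr d N k) (f : Linf Ω (Sp d)) (u : L2 Ω (Sp d))
    (A : Set (Sp N)) : ℝ :=
  (∫ x in Ω, 2 * inner ℝ (f x) (u x)) -
    ∫ x in Ω, inner ℝ (sigma Ω σ₁ σ₂ A x (weakOp k op Ω u x)) (weakOp k op Ω u x)

theorem integral_inner_Linf {f' : L2 Ω (Sp d)} (hf : f' =ᵐ[volume.restrict Ω] f)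
    (u : L2 Ω (Sp d)) : ∫ x in Ω, inner ℝ (f x) (u x) = inner ℝ f' u := by
  rw [L2.inner_def]
  refine integral_congr_ae ?_
  filter_upwards [hf] with x hx
  rw [hx]

theorem bulkEnergy_eq (hΩo : IsOpen Ω) (hA : MeasurableSet A) {f' : L2 Ω (Sp d)}
    (hf : f' =ᵐ[volume.restrict Ω] f) (u : L2 Ω (Sp d)) :
    bulkEnergy Ω op σ₁ σ₂ f u A = 2 * inner ℝ f' u -
      inner ℝ (sigmaL2 hΩo.measurableSet σ₁ σ₂ hA (weakOp k op Ω u)) (weakOp k op Ω u) := by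
  rw [bulkEnergy, inner_sigmaL2, integral_const_mul, integral_inner_Linf hf]

/-- Completing the square: `w_A` maximizes the bulk energy. -/
theorem bulkEnergy_add_le (hΩo : IsOpen Ω) (hΩb : Bornology.IsBounded Ω)
    {C : ℝ} (hC0 : 0 < C)
    (hC : ∀ φ : Sp N → Sp d, IsTest Ω φ → ∫ x, ‖φ x‖ ^ 2 ≤ C * ∫ x, ‖applyOp k op φ x‖ ^ 2)
    {m : ℝ} (hm : 0 < m) (hs₁ : σ₁.IsSymmetric) (hs₂ : σ₂.IsSymmetric)
    (hσ₁ : ∀ P, m * ‖P‖ ^ 2 ≤ inner ℝ (σ₁ P) P)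
    (hσ₂ : ∀ P, m * ‖P‖ ^ 2 ≤ inner ℝ (σ₂ P) P) (hA : MeasurableSet A) {u w : L2 Ω (Sp d)}
    (hw : IsState Ω op σ₁ σ₂ f A w) (hu : u ∈ WA0 k op Ω) :
    bulkEnergy Ω op σ₁ σ₂ f u A + m / C * ‖u - w‖ ^ 2 ≤ ∫ x in Ω, inner ℝ (f x) (w x) := by
  obtain ⟨f', hf⟩ := exists_L2_eq_Linf hΩb f
  rw [bulkEnergy_eq hΩo hA hf, integral_inner_Linf hf]
  obtain ⟨hw0, hw⟩ := (isState_iff hΩo hA hf).1 hw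
  have hgu := toLp_weakOp_mem_opGraph hΩo hu
  have hgw := toLp_weakOp_mem_opGraph hΩo hw0
  have h1 : (inner ℝ (sigmaL2 hΩo.measurableSet σ₁ σ₂ hA (weakOp k op Ω w)) (weakOp k op Ω u) : ℝ) =
    inner ℝ f' u := hw _ hgu
  have h2 : (inner ℝ (sigmaL2 hΩo.measurableSet σ₁ σ₂ hA (weakOp k op Ω w)) (weakOp k op Ω w) : ℝ) =
    inner ℝ f' w := hw _ hgw
  have hsub := sub_mem_opGraph hgu hgw
  have h3 : ‖u - w‖ ^ 2 ≤ C * ‖weakOp k op Ω u - weakOp k op Ω w‖ ^ 2 :=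
    norm_sq_le_of_mem_opGraph hC hsub
  have h4 := le_inner_sigmaL2 hΩo.measurableSet hσ₁ hσ₂ hA (weakOp k op Ω u - weakOp k op Ω w)
  have h6 := inner_sigmaL2_comm hΩo.measurableSet hs₁ hs₂ hA (weakOp k op Ω u) (weakOp k op Ω w)
  generalize sigmaL2 hΩo.measurableSet σ₁ σ₂ hA = S at *
  generalize weakOp k op Ω u = gu at *
  generalize weakOp k op Ω w = gw at *
  -- By symmetry both cross terms equal ⟨f', u⟩, so the quadratic form at 𝒜u − 𝒜w is ⟨f', w⟩ minus
  -- the bulk energy of u.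
  rw [map_sub, inner_sub_left, inner_sub_right, inner_sub_right, h1, h2, h6, h1] at h4
  have h5 : m / C * ‖u - w‖ ^ 2 ≤ m * ‖gu - gw‖ ^ 2 := by
    rw [div_mul_eq_mul_div, div_le_iff₀ hC0]
    calc m * ‖u - w‖ ^ 2 ≤ m * (C * ‖gu - gw‖ ^ 2) :=
          mul_le_mul_of_nonneg_left h3 hm.le
      _ = _ := by ring
  linarith

theorem bulkEnergy_state (hΩo : IsOpen Ω) (hΩb : Bornology.IsBounded Ω)
    (hA : MeasurableSet A) {w : L2 Ω (Sp d)} (hw : IsState Ω op σ₁ σ₂ f A w) :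
    bulkEnergy Ω op σ₁ σ₂ f w A = ∫ x in Ω, inner ℝ (f x) (w x) := by
  obtain ⟨f', hf⟩ := exists_L2_eq_Linf hΩb f
  rw [bulkEnergy_eq hΩo hA hf, integral_inner_Linf hf]
  obtain ⟨hw0, hw⟩ := (isState_iff hΩo hA hf).1 hw
  have h2 : (inner ℝ (sigmaL2 hΩo.measurableSet σ₁ σ₂ hA (weakOp k op Ω w)) (weakOp k op Ω w) : ℝ) =
    inner ℝ f' w := hw _ (toLp_weakOp_mem_opGraph hΩo hw0)
  linarith

theorem zero_mem_WA0 (hΩo : IsOpen Ω) : (0 : L2 Ω (Sp d)) ∈ WA0 k op Ω :=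
  (mem_WA0_iff hΩo).2 ⟨0, Submodule.zero_mem _⟩

theorem bulkEnergy_zero (hΩo : IsOpen Ω) (hΩb : Bornology.IsBounded Ω) (hA : MeasurableSet A) :
    bulkEnergy Ω op σ₁ σ₂ f 0 A = 0 := by
  obtain ⟨f', hf⟩ := exists_L2_eq_Linf hΩb f
  have h0 : HasWeakOp k op Ω (0 : L2 Ω (Sp d)) 0 :=
    hasWeakOp_of_mem_opGraph (Submodule.zero_mem (opGraph k op Ω))
  rw [bulkEnergy_eq hΩo hA hf, weakOp_eq hΩo h0]
  simp

/-- The bulk energy is continuous under convergence of the designs almost everywhere in `Ω`. -/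
theorem tendsto_bulkEnergy (hΩo : IsOpen Ω) (u : L2 Ω (Sp d)) {An : ℕ → Set (Sp N)}
    (hAn : ∀ n, MeasurableSet (An n))
    (h : ∀ᵐ x ∂(volume.restrict Ω), ∀ᶠ n in atTop, (x ∈ An n ↔ x ∈ A)) :
    Tendsto (fun n => bulkEnergy Ω op σ₁ σ₂ f u (An n)) atTop
      (𝓝 (bulkEnergy Ω op σ₁ σ₂ f u A)) := by
  refine tendsto_const_nhds.sub ?_
  obtain ⟨K, hK0, hK⟩ := exists_norm_sigma_le Ω σ₁ σ₂
  set g := weakOp k op Ω u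
  refine tendsto_integral_of_dominated_convergence (fun x => K * inner ℝ (g x) (g x)) ?_
    ((L2.integrable_inner g g).const_mul K) ?_ ?_
  · intro n
    exact (memLp_sigma hΩo.measurableSet σ₁ σ₂ (hAn n) g).aestronglyMeasurable.inner
      (Lp.memLp g).aestronglyMeasurable
  · refine fun n => Eventually.of_forall fun x => (norm_inner_le_norm _ _).trans ?_
    rw [real_inner_self_eq_norm_sq, sq, ← mul_assoc]
    exact mul_le_mul_of_nonneg_right (hK _ _ _) (norm_nonneg _)
  · filter_upwards [h, ae_restrict_mem hΩo.measurableSet] with x hx hxΩ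
    refine tendsto_const_nhds.congr' ?_
    filter_upwards [hx] with n hn
    by_cases hxA : x ∈ A
    · rw [sigma_of_mem hxA, sigma_of_mem (hn.2 hxA)]
    · rw [sigma_of_notMem hxΩ hxA, sigma_of_notMem hxΩ fun h => hxA (hn.1 h)]

end States

/-! ### Variation on open sets and semicontinuity of the perimeter -/

section Variation

variable {N : ℕ} {A A' U V K : Set (Sp N)}

theorem exists_smooth_cutoff (hK : IsCompact K) (hV : IsOpen V) (hKV : K ⊆ V) :
    ∃ χ : Sp N → ℝ, IsTest V χ ∧ (∀ x, 0 ≤ χ x) ∧ (∀ x, χ x ≤ 1) ∧ ∀ᶠ x in 𝓝ˢ K, χ x = 1 := by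
  obtain ⟨δ, hδ, hδV⟩ := hK.exists_cthickening_subset_open hV hKV
  obtain ⟨χ, hχ, hrange, hsupp, hone⟩ := exists_contMDiff_support_eq_eq_one_iff
    (modelWithCornersSelf ℝ (Sp N)) (Metric.isOpen_thickening (δ := δ) (E := K))
    (Metric.isClosed_cthickening (δ := δ / 2) (E := K))
    (Metric.cthickening_subset_thickening' hδ (by linarith) K)
  have hts : tsupport χ ⊆ Metric.cthickening δ K :=
    closure_minimal (hsupp.trans_subset (Metric.thickening_subset_cthickening _ _))
      Metric.isClosed_cthickening
  refine ⟨χ, ⟨hχ.contDiff, hK.cthickening.of_isClosed_subset (isClosed_tsupport _) hts,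
    hts.trans hδV⟩, fun x => (hrange (mem_range_self x)).1, fun x => (hrange (mem_range_self x)).2,
    ?_⟩
  filter_upwards [Metric.cthickening_mem_nhdsSet K (half_pos hδ)] with x hx
  exact (hone x).1 hx

theorem IsTest.divergence {T : Sp N → Sp N} (h : IsTest U T) : IsTest U (divergence T) := by
  have h1 : ContDiff ℝ ∞ (OptimalDesign.divergence T) :=
    ContDiff.sum fun i _ => (EuclideanSpace.proj i : Sp N →L[ℝ] ℝ).contDiff.comp
      (contDiff_partialDeriv i h.1)
  refine h.of_tsupport_subset h1 (closure_minimal (fun x hx => ?_) (isClosed_tsupport _))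
  by_contra hx'
  refine hx (Finset.sum_eq_zero fun i _ => ?_)
  rw [image_eq_zero_of_notMem_tsupport fun h => hx' (tsupport_partialDeriv_subset i T h)]
  rfl

theorem divergence_add {T T' : Sp N → Sp N} (h : ContDiff ℝ ∞ T) (h' : ContDiff ℝ ∞ T') :
    divergence (T + T') = divergence T + divergence T' := by
  ext1 x
  simp [divergence, partialDeriv_add _ h h', Finset.sum_add_distrib]

theorem divergence_const_smul (c : ℝ) {T : Sp N → Sp N} (h : ContDiff ℝ ∞ T) :
    divergence (c • T) = c • divergence T := by
  ext1 x
  simp [divergence, partialDeriv_const_smul _ c h, Finset.mul_sum]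

theorem setIntegral_divergence_add {T T' : Sp N → Sp N} (h : IsTest U T) (h' : IsTest V T') :
    ∫ x in A, divergence (T + T') x =
      (∫ x in A, divergence T x) + ∫ x in A, divergence T' x := by
  rw [divergence_add h.1 h'.1]
  exact integral_add h.divergence.integrable.integrableOn h'.divergence.integrable.integrableOn

theorem le_variationOpen {T : Sp N → Sp N} (h : IsTest U T) (h1 : ∀ x, ‖T x‖ ≤ 1) :
    ENNReal.ofReal (∫ x in A, divergence T x) ≤ variationOpen A U :=
  le_iSup₂_of_le (f := fun (T : Sp N → Sp N) (_ : IsTest U T ∧ ∀ x, ‖T x‖ ≤ 1) =>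
    ENNReal.ofReal (∫ x in A, divergence T x)) T ⟨h, h1⟩ le_rfl

theorem variationOpen_mono (h : U ⊆ V) : variationOpen A U ≤ variationOpen A V :=
  iSup₂_le fun _ hT => le_variationOpen (hT.1.mono h) hT.2

theorem setIntegral_divergence_le (hfin : variationOpen A U ≠ ⊤) {T : Sp N → Sp N}
    (h : IsTest U T) {c : ℝ} (hc : 0 ≤ c) (h1 : ∀ x, ‖T x‖ ≤ c) :
    ∫ x in A, divergence T x ≤ c * (variationOpen A U).toReal := by
  refine le_of_forall_pos_le_add fun ε hε => ?_
  set v := (variationOpen A U).toReal with hv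
  have hv0 : 0 ≤ v := ENNReal.toReal_nonneg
  -- The field is normalized by b instead of c because c may vanish; the resulting error ε v / (v +
  -- 1) is at most ε.
  set b : ℝ := c + ε / (v + 1) with hb
  have hb0 : 0 < b := by positivity
  have h2 : ∫ x in A, divergence (b⁻¹ • T) x ≤ v := by
    refine (ENNReal.ofReal_le_iff_le_toReal hfin).1 (le_variationOpen (h.const_smul _) fun x => ?_)
    rw [Pi.smul_apply, norm_smul, norm_inv, Real.norm_eq_abs, abs_of_pos hb0,
      inv_mul_le_iff₀ hb0, mul_one]
    exact (h1 x).trans (le_add_of_nonneg_right (by positivity))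
  rw [divergence_const_smul _ h.1] at h2
  simp only [Pi.smul_apply, smul_eq_mul, integral_const_mul] at h2
  rw [inv_mul_le_iff₀ hb0] at h2
  refine h2.trans ?_
  rw [hb, add_mul]
  have : ε / (v + 1) * v ≤ ε := by
    rw [div_mul_eq_mul_div, div_le_iff₀ (by positivity)]
    nlinarith
  linarith

theorem setIntegral_congr_of_eqOn_support {F : Sp N → ℝ} (h : IsTest U F)
    (hA : MeasurableSet A) (hA' : MeasurableSet A')
    (hAA' : ∀ᵐ x, x ∈ U → (x ∈ A ↔ x ∈ A')) : ∫ x in A, F x = ∫ x in A', F x := by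
  rw [← integral_indicator hA, ← integral_indicator hA']
  refine integral_congr_ae ?_
  filter_upwards [hAA'] with x hx
  by_cases hxU : x ∈ U
  · by_cases hxA : x ∈ A
    · rw [indicator_of_mem hxA, indicator_of_mem ((hx hxU).1 hxA)]
    · rw [indicator_of_notMem hxA, indicator_of_notMem fun h => hxA ((hx hxU).2 h)]
  · simp [indicator, h.eq_zero_of_notMem hxU]

theorem variationOpen_le_of_ae_eq (hA : MeasurableSet A) (hA' : MeasurableSet A')
    (hAA' : ∀ᵐ x, x ∈ U → (x ∈ A ↔ x ∈ A')) : variationOpen A U ≤ variationOpen A' U :=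
  iSup₂_le fun _ hT => by
    rw [setIntegral_congr_of_eqOn_support hT.1.divergence hA hA' hAA']
    exact le_variationOpen hT.1 hT.2

/-- A cutoff χ supported in V splits T into χT and (1 − χ)T, both of norm at most 1. As χ = 1 in a
neighbourhood of K, and not just on K, the second part is supported off K. -/
theorem variationOpen_le_add (hK : IsCompact K) (hV : IsOpen V) (hKV : K ⊆ V) :
    variationOpen A U ≤ variationOpen A V + variationOpen A (U \ K) := by
  refine iSup₂_le fun T hT => ?_
  obtain ⟨χ, hχ, hχ0, hχ1, hχK⟩ := exists_smooth_cutoff hK hV hKV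
  have h1 : IsTest V fun x => χ x • T x :=
    hχ.of_tsupport_subset (hχ.1.smul hT.1.1) (closure_mono fun x hx hx' => hx (by simp [hx']))
  have hs2 : tsupport (fun x => (1 - χ x) • T x) ⊆ tsupport T :=
    closure_mono fun x hx hx' => hx (by simp [hx'])
  have h2 : IsTest (U \ K) fun x => (1 - χ x) • T x := by
    refine ⟨(contDiff_const.sub hχ.1).smul hT.1.1,
      hasCompactSupport_of_tsupport_subset hT.1.2.1 hs2,
      fun x hx => ⟨hT.1.2.2 (hs2 hx), fun hxK => ?_⟩⟩
    have h3 : ∀ᶠ y in 𝓝 x, (1 - χ y) • T y = 0 := by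
      filter_upwards [eventually_nhdsSet_iff_forall.1 hχK x hxK] with y hy
      rw [hy, sub_self, zero_smul]
    exact (notMem_tsupport_iff_eventuallyEq.2 h3) hx
  have e : T = (fun x => χ x • T x) + fun x => (1 - χ x) • T x := by
    ext1 x
    rw [Pi.add_apply, ← add_smul]
    simp
  rw [e, setIntegral_divergence_add h1 h2]
  refine ENNReal.ofReal_add_le.trans (add_le_add (le_variationOpen h1 fun x => ?_)
    (le_variationOpen h2 fun x => ?_))
  · rw [norm_smul, Real.norm_eq_abs, abs_of_nonneg (hχ0 x)]
    exact mul_le_one₀ (hχ1 x) (norm_nonneg _) (hT.2 x)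
  · rw [norm_smul, Real.norm_eq_abs, abs_of_nonneg (sub_nonneg.2 (hχ1 x))]
    exact mul_le_one₀ (by linarith [hχ0 x]) (norm_nonneg _) (hT.2 x)

theorem tendsto_setIntegral {An : ℕ → Set (Sp N)} (hAn : ∀ n, MeasurableSet (An n))
    (hA : MeasurableSet A) (h : ∀ᵐ x, ∀ᶠ n in atTop, (x ∈ An n ↔ x ∈ A)) {F : Sp N → ℝ}
    (hF : Integrable F) :
    Tendsto (fun n => ∫ x in An n, F x) atTop (𝓝 (∫ x in A, F x)) := by
  simp only [← integral_indicator hA, ← integral_indicator (hAn _)]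
  refine tendsto_integral_of_dominated_convergence (fun x => ‖F x‖)
    (fun n => hF.aestronglyMeasurable.indicator (hAn n)) hF.norm
    (fun n => Eventually.of_forall fun x => norm_indicator_le_norm_self _ _) ?_
  filter_upwards [h] with x hx
  refine tendsto_const_nhds.congr' ?_
  filter_upwards [hx] with n hn
  by_cases hxA : x ∈ A
  · rw [indicator_of_mem hxA, indicator_of_mem (hn.2 hxA)]
  · rw [indicator_of_notMem hxA, indicator_of_notMem fun h => hxA (hn.1 h)]

/-- Lower semicontinuity of the variation on open sets. -/
theorem variationOpen_le_of_tendsto {An : ℕ → Set (Sp N)} (hAn : ∀ n, MeasurableSet (An n))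
    (hA : MeasurableSet A) (h : ∀ᵐ x, ∀ᶠ n in atTop, (x ∈ An n ↔ x ∈ A)) {c : ℝ≥0∞}
    (hc : ∀ᶠ n in atTop, variationOpen (An n) U ≤ c) : variationOpen A U ≤ c := by
  refine iSup₂_le fun T hT => ?_
  refine le_of_tendsto ((ENNReal.continuous_ofReal.tendsto _).comp
    (tendsto_setIntegral hAn hA h hT.1.divergence.integrable)) ?_
  filter_upwards [hc] with n hn
  exact (le_variationOpen hT.1 hT.2).trans hn

/-- Continuity from above of the variation measure along neighbourhoods of `K`. -/
theorem exists_isOpen_variationOpen_diff_le (hU : IsOpen U) (hKU : K ⊆ U)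
    (hfin : variationOpen A (U \ K) ≠ ⊤) {ε : ℝ≥0∞} (hε : ε ≠ 0) :
    ∃ V, IsOpen V ∧ K ⊆ V ∧ V ⊆ U ∧ variationOpen A (V \ K) ≤ ε := by
  -- A field T₁ that is optimal up to ε on U \ K has compact support away from K. Removing this
  -- support leaves a neighbourhood of K in which little variation remains.
  have h1 : ∃ T : Sp N → Sp N, (IsTest (U \ K) T ∧ ∀ x, ‖T x‖ ≤ 1) ∧
      variationOpen A (U \ K) ≤ ENNReal.ofReal (∫ x in A, divergence T x) + ε := by
    rcases eq_or_ne (variationOpen A (U \ K)) 0 with h0 | h0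
    · exact ⟨0, ⟨isTest_zero _, by simp⟩, by rw [h0]; exact zero_le⟩
    · have hlt := ENNReal.sub_lt_self hfin h0 hε
      obtain ⟨T, hT⟩ := lt_iSup_iff.1 hlt
      obtain ⟨hT', hlt'⟩ := lt_iSup_iff.1 hT
      exact ⟨T, hT', tsub_le_iff_right.1 hlt'.le⟩
  obtain ⟨T₁, hT₁, hle⟩ := h1
  refine ⟨U \ tsupport T₁, hU.sdiff (isClosed_tsupport _),
    fun x hx => ⟨hKU hx, fun h => (hT₁.1.2.2 h).2 hx⟩, sdiff_subset, iSup₂_le fun T hT => ?_⟩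
  have hT' : IsTest (U \ K) T := hT.1.mono (sdiff_subset_sdiff_left sdiff_subset)
  by_contra! hcon
  -- Since T vanishes on the support of T₁, the sum T₁ + T is still a competitor on U \ K.
  have hsum := le_variationOpen (A := A) (hT₁.1.add hT') fun x => by
    by_cases hx : x ∈ tsupport T₁
    · rw [Pi.add_apply, hT.1.eq_zero_of_notMem fun h => h.1.2 hx, add_zero]
      exact hT₁.2 x
    · rw [Pi.add_apply, image_eq_zero_of_notMem_tsupport hx, zero_add]
      exact hT.2 x
  rw [setIntegral_divergence_add hT₁.1 hT'] at hsum
  have hb : 0 ≤ ∫ x in A, divergence T x := by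
    by_contra! h
    rw [ENNReal.ofReal_of_nonpos h.le] at hcon
    exact not_lt_zero hcon
  -- `ENNReal.ofReal` truncates at 0 and is additive only for nonnegative terms; if the flux of T₁
  -- is nonpositive, the variation on U \ K is already at most ε.
  rcases le_total 0 (∫ x in A, divergence T₁ x) with ha | ha
  · rw [ENNReal.ofReal_add ha hb] at hsum
    have := (ENNReal.add_le_add_iff_left ENNReal.ofReal_ne_top).1 (hsum.trans hle)
    exact absurd this (not_le.2 hcon)
  · rw [ENNReal.ofReal_of_nonpos ha, zero_add] at hle
    exact absurd ((le_variationOpen hT' hT.2).trans hle) (not_le.2 hcon)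

theorem Per_le_variationOpen (hU : IsOpen U) (hKU : K ⊆ U) : Per A K ≤ variationOpen A U :=
  iInf₂_le U ⟨hU, hKU⟩

theorem variationOpen_lt_top_of_isLocallyFinitePerimeter (hA : IsLocallyFinitePerimeter A)
    (hU : Bornology.IsBounded U) : variationOpen A U < ⊤ := by
  have h := hA.2 (closure U) hU.isCompact_closure
  obtain ⟨V, hV⟩ := iInf_lt_iff.1 h
  obtain ⟨hV', hlt⟩ := iInf_lt_iff.1 hV
  exact (variationOpen_mono (subset_closure.trans hV'.2)).trans_lt hlt

variable {Ω A₀ : Set (Sp N)}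

theorem IsAdmissible.ae_mem_iff (h : IsAdmissible Ω A₀ A) :
    ∀ᵐ x, x ∉ Ω → (x ∈ A ↔ x ∈ A₀) := by
  filter_upwards [h.2.mem_iff] with x hx hxΩ
  simpa [hxΩ] using hx

/-- Away from Ω̄ the design agrees with A₀. So, cutting off at any neighbourhood of Ω̄ and
minimizing over such neighbourhoods, the perimeter on Ω̄ controls the variation on every set U up to
a term independent of the design. -/
theorem variationOpen_le_Per_add (hΩb : Bornology.IsBounded Ω)
    (hA₀ : IsLocallyFinitePerimeter A₀) (h : IsAdmissible Ω A₀ A) (U : Set (Sp N)) :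
    variationOpen A U ≤ Per A (closure Ω) + variationOpen A₀ (U \ closure Ω) := by
  unfold Per
  simp only [ENNReal.iInf_add]
  refine le_iInf₂ fun V hV => (variationOpen_le_add hΩb.isCompact_closure hV.1 hV.2).trans ?_
  refine add_le_add le_rfl (variationOpen_le_of_ae_eq h.1.1 hA₀.1 ?_)
  filter_upwards [h.ae_mem_iff] with x hx hxU
  exact hx fun hxΩ => hxU.2 (subset_closure hxΩ)

theorem isAdmissible_self (hA₀ : IsLocallyFinitePerimeter A₀) : IsAdmissible Ω A₀ A₀ :=
  ⟨hA₀, ae_eq_refl _⟩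

variable {An : ℕ → Set (Sp N)}

/-- Lower semicontinuity of the perimeter in `Ω̄` among admissible designs. -/
theorem Per_le_of_tendsto (hΩb : Bornology.IsBounded Ω)
    (hA₀ : IsLocallyFinitePerimeter A₀) (hAn : ∀ n, IsAdmissible Ω A₀ (An n))
    (hA : MeasurableSet A) (h : ∀ᵐ x, ∀ᶠ n in atTop, (x ∈ An n ↔ x ∈ A)) {c : ℝ≥0∞}
    (hc : ∀ᶠ n in atTop, Per (An n) (closure Ω) ≤ c) : Per A (closure Ω) ≤ c := by
  refine ENNReal.le_of_forall_pos_le_add fun ε hε _ => ?_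
  have hfin : variationOpen A₀ (Metric.thickening 1 (closure Ω) \ closure Ω) ≠ ⊤ :=
    (variationOpen_lt_top_of_isLocallyFinitePerimeter hA₀
      ((hΩb.closure.thickening (δ := 1)).subset sdiff_subset)).ne
  -- Semicontinuity is available on open sets, so Ω̄ is enlarged to V with at most ε of the
  -- variation of A₀ in V \ Ω̄; eventually the designs then have variation at most c + ε on V.
  obtain ⟨V, hVo, hKV, -, hV⟩ := exists_isOpen_variationOpen_diff_le Metric.isOpen_thickening
    (Metric.self_subset_thickening one_pos (closure Ω)) hfin (ENNReal.coe_pos.2 hε).ne'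
  refine (Per_le_variationOpen hVo hKV).trans
    (variationOpen_le_of_tendsto (fun n => (hAn n).1.1) hA h ?_)
  filter_upwards [hc] with n hn
  exact (variationOpen_le_Per_add hΩb hA₀ (hAn n) V).trans (add_le_add hn hV)

theorem isAdmissible_of_tendsto (hΩb : Bornology.IsBounded Ω)
    (hA₀ : IsLocallyFinitePerimeter A₀) (hAn : ∀ n, IsAdmissible Ω A₀ (An n))
    (hA : MeasurableSet A) (h : ∀ᵐ x, ∀ᶠ n in atTop, (x ∈ An n ↔ x ∈ A)) {c : ℝ≥0∞}
    (hctop : c ≠ ⊤) (hc : ∀ᶠ n in atTop, Per (An n) (closure Ω) ≤ c) : IsAdmissible Ω A₀ A := by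
  refine ⟨⟨hA, fun K hK => ?_⟩, ?_⟩
  · have hb : Bornology.IsBounded (Metric.thickening 1 K) := hK.isBounded.thickening
    have hfin := variationOpen_lt_top_of_isLocallyFinitePerimeter hA₀ hb
    refine ((Per_le_variationOpen Metric.isOpen_thickening
      (Metric.self_subset_thickening one_pos K)).trans
      (variationOpen_le_of_tendsto (fun n => (hAn n).1.1) hA h
        (c := c + variationOpen A₀ (Metric.thickening 1 K)) ?_)).trans_lt
      (ENNReal.add_lt_top.2 ⟨hctop.lt_top, hfin⟩)
    filter_upwards [hc] with n hn
    exact (variationOpen_le_Per_add hΩb hA₀ (hAn n) _).trans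
      (add_le_add hn (variationOpen_mono sdiff_subset))
  · rw [eventuallyEq_set]
    filter_upwards [h, ae_all_iff.2 fun n => (hAn n).ae_mem_iff] with x hx hx'
    obtain ⟨n, hn⟩ := hx.exists
    exact and_congr_left fun hxΩ => hn.symm.trans (hx' n hxΩ)

end Variation

/-! ### Translation estimate for sets of finite variation -/

section Translation

variable {N : ℕ} {A E U Ω : Set (Sp N)}

/-- The integral is the convolution of 𝟙_A with y ↦ χ(−y), and the derivative falls on the smooth
factor. -/
theorem hasDerivAt_setIntegral_comp_sub (hA : MeasurableSet A) {χ : Sp N → ℝ} (hχ : IsTest Ω χ)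
    (z : Sp N) (t : ℝ) :
    HasDerivAt (fun t : ℝ => ∫ y in A, χ (y - t • z))
      (∫ y in A, -(fderiv ℝ χ (y - t • z) z)) t := by
  set g : Sp N → ℝ := fun y => χ (-y) with hg
  have hgs : ContDiff ℝ ∞ g := hχ.1.comp contDiff_neg
  have hgc : HasCompactSupport g := hχ.2.1.comp_homeomorph (Homeomorph.neg (Sp N))
  have hloc : LocallyIntegrable (A.indicator fun _ => (1 : ℝ)) (volume : Measure (Sp N)) :=
    (locallyIntegrable_const 1).indicator hA
  have hfd : ∀ y v, fderiv ℝ g y v = -(fderiv ℝ χ (-y) v) := by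
    intro y v
    have h := (hχ.1.differentiable (by simp) (-y)).hasFDerivAt.comp y (hasFDerivAt_id y).neg
    have h' : fderiv ℝ g y = _ := h.fderiv
    rw [h']
    simp
  have hconv : ∀ (F G : Sp N → ℝ), (∀ y, F y = G (-y)) → ∀ x : Sp N,
      convolution (A.indicator fun _ => (1 : ℝ)) G (ContinuousLinearMap.lsmul ℝ ℝ) volume x =
        ∫ y in A, F (y - x) := by
    intro F G hFG x
    rw [convolution_def, ← integral_indicator hA]
    refine integral_congr_ae (Eventually.of_forall fun y => ?_)
    by_cases hy : y ∈ A
    · simp [hy, hFG]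
    · simp [hy]
  have h1 := hgc.hasFDerivAt_convolution_right (ContinuousLinearMap.lsmul ℝ ℝ) hloc
    (hgs.of_le (by simp)) (t • z)
  have h2 : HasDerivAt (fun t : ℝ => t • z) z t := by
    simpa using (hasDerivAt_id t).smul_const z
  have h3 := h1.comp_hasDerivAt t h2
  rw [convolution_precompR_apply _ hloc (hgc.fderiv ℝ) (hgs.continuous_fderiv (by simp)),
    hconv (fun y => -(fderiv ℝ χ y z)) _ fun y => by rw [hfd, neg_neg]] at h3
  refine h3.congr_of_eventuallyEq (Eventually.of_forall fun s => ?_)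
  exact hconv χ g (fun y => by simp [hg]) (s • z) |>.symm

theorem isTest_comp_sub_smul {χ : Sp N → ℝ} (hχ : IsTest Ω χ) {w : Sp N}
    (hw : ∀ x ∈ Ω, x + w ∈ U) (v : Sp N) : IsTest U fun y => χ (y - w) • v := by
  have hs : tsupport (fun y => χ (y - w) • v) ⊆ (Homeomorph.subRight w) ⁻¹' (tsupport χ) := by
    refine closure_minimal (fun y hy => subset_tsupport χ fun h => hy ?_)
      ((isClosed_tsupport χ).preimage (Homeomorph.subRight w).continuous)
    simp only [Homeomorph.coe_subRight] at h
    simp [h]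
  refine ⟨(hχ.1.comp (contDiff_id.sub contDiff_const)).smul contDiff_const,
    ((Homeomorph.subRight w).isCompact_preimage.2 hχ.2.1).of_isClosed_subset
      (isClosed_tsupport _) hs, fun y hy => ?_⟩
  simpa using hw _ (hχ.2.2 (hs hy))

theorem divergence_comp_sub_smul {χ : Sp N → ℝ} (hχ : ContDiff ℝ ∞ χ) (w v y : Sp N) :
    divergence (fun y => χ (y - w) • v) y = fderiv ℝ χ (y - w) v := by
  have h1 : HasFDerivAt (fun y => χ (y - w)) (fderiv ℝ χ (y - w)) y :=
    (hχ.differentiable (by simp) (y - w)).hasFDerivAt.comp y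
      ((hasFDerivAt_id y).sub_const w)
  have h2 := h1.smul_const v
  have h3 : v = ∑ i, v i • EuclideanSpace.single i (1 : ℝ) := by
    simpa using ((EuclideanSpace.basisFun (Fin N) ℝ).sum_repr v).symm
  unfold divergence partialDeriv
  rw [h2.fderiv]
  conv_rhs => rw [h3, map_sum]
  refine Finset.sum_congr rfl fun i _ => ?_
  simp [mul_comm]

/-- The t-derivative of ∫_A χ(y − tz) is minus the flux over A of div(χ(· − tz) z). This field is
bounded by |z| and supported in U, so the variation bounds the derivative; the mean value inequality
on [0, 1] concludes. -/
theorem abs_setIntegral_comp_sub_sub_le (hA : MeasurableSet A) (hfin : variationOpen A U ≠ ⊤)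
    {r : ℝ} (hr : ∀ x ∈ Ω, Metric.closedBall x r ⊆ U) {χ : Sp N → ℝ} (hχ : IsTest Ω χ)
    (hχ1 : ∀ x, |χ x| ≤ 1) {z : Sp N} (hz : ‖z‖ ≤ r) :
    |(∫ y in A, χ (y - z)) - ∫ y in A, χ y| ≤ r * (variationOpen A U).toReal := by
  have h1 : ∀ t ∈ Ico (0 : ℝ) 1, ‖∫ y in A, -(fderiv ℝ χ (y - t • z) z)‖ ≤
      r * (variationOpen A U).toReal := by
    intro t ht
    have hw : ∀ x ∈ Ω, x + t • z ∈ U := fun x hx => hr x hx <| by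
      rw [mem_closedBall_iff_norm, add_sub_cancel_left, norm_smul, Real.norm_eq_abs,
        abs_of_nonneg ht.1]
      exact (mul_le_of_le_one_left (norm_nonneg _) ht.2.le).trans hz
    have hb : ∀ v : Sp N, ‖v‖ ≤ r → ∫ y in A, fderiv ℝ χ (y - t • z) v ≤
        r * (variationOpen A U).toReal := by
      intro v hv
      have := setIntegral_divergence_le hfin (isTest_comp_sub_smul hχ hw v)
        ((norm_nonneg v).trans hv) fun y => by
          rw [norm_smul, Real.norm_eq_abs]
          exact (mul_le_of_le_one_left (norm_nonneg _) (hχ1 _)).trans hv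
      simpa only [divergence_comp_sub_smul hχ.1] using this
    rw [Real.norm_eq_abs, abs_le]
    constructor
    · rw [integral_neg]
      exact neg_le_neg (hb z hz)
    · have := hb (-z) (by rwa [norm_neg])
      simpa only [map_neg] using this
  have h2 := norm_image_sub_le_of_norm_deriv_le_segment_01'
    (fun t _ => (hasDerivAt_setIntegral_comp_sub hA hχ z t).hasDerivWithinAt) h1
  simpa using h2

/-- Inner and outer regularity squeeze E between a compact K and an open O of nearly the same
measure. A smooth cutoff between them differs from 𝟙_E only on O \ K, and |g| ≤ 1. -/
theorem abs_setIntegral_le_of_forall_isTest (hΩ : IsOpen Ω) {g : Sp N → ℝ} (hg : Measurable g)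
    (hg1 : ∀ x, |g x| ≤ 1) {C : ℝ}
    (h : ∀ χ : Sp N → ℝ, IsTest Ω χ → (∀ x, |χ x| ≤ 1) → |∫ x, χ x * g x| ≤ C)
    (hE : MeasurableSet E) (hEΩ : E ⊆ Ω) (hEfin : volume E ≠ ⊤) : |∫ x in E, g x| ≤ C := by
  refine le_of_forall_pos_le_add fun ε hε => ?_
  have hε' : ENNReal.ofReal (ε / 2) ≠ 0 := by simpa using hε
  obtain ⟨K, hKE, hK, hKlt⟩ := hE.exists_isCompact_sdiff_lt hEfin hε'
  obtain ⟨O, hEO, hO, -, hOlt⟩ := hE.exists_isOpen_sdiff_lt hEfin hε'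
  obtain ⟨χ, hχ, hχ0, hχ1, hχK⟩ := exists_smooth_cutoff hK (hO.inter hΩ)
    (hKE.trans (subset_inter hEO hEΩ))
  have hχK' : ∀ x ∈ K, χ x = 1 := fun x hx => (eventually_nhdsSet_iff_forall.1 hχK x hx).self_of_nhds
  have habs : ∀ x, |χ x| ≤ 1 := fun x => by
    rw [abs_of_nonneg (hχ0 x)]
    exact hχ1 x
  have hOK : volume (O \ K) < ENNReal.ofReal ε := by
    calc volume (O \ K) ≤ volume (O \ E ∪ E \ K) :=
          measure_mono fun x hx => by
            by_cases hxE : x ∈ E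
            · exact Or.inr ⟨hxE, hx.2⟩
            · exact Or.inl ⟨hx.1, hxE⟩
      _ ≤ volume (O \ E) + volume (E \ K) := measure_union_le _ _
      _ < ENNReal.ofReal (ε / 2) + ENNReal.ofReal (ε / 2) := ENNReal.add_lt_add hOlt hKlt
      _ = ENNReal.ofReal ε := by
          rw [← ENNReal.ofReal_add (by positivity) (by positivity), add_halves]
  have hOKm : MeasurableSet (O \ K) := hO.measurableSet.diff hK.measurableSet
  have i1 : Integrable (E.indicator g) := by
    rw [integrable_indicator_iff hE]
    exact Measure.integrableOn_of_bounded hEfin hg.aestronglyMeasurable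
      (Eventually.of_forall fun x => hg1 x)
  have i2 : Integrable fun x => χ x * g x :=
    hχ.integrable.mul_bdd (c := 1) hg.aestronglyMeasurable (Eventually.of_forall fun x => hg1 x)
  have i3 : Integrable ((O \ K).indicator fun _ => (1 : ℝ)) :=
    (integrable_indicator_iff hOKm).2 (integrableOn_const (hOK.trans ENNReal.ofReal_lt_top).ne)
  have e1 : ∫ x in E, g x = (∫ x, χ x * g x) + ∫ x, (E.indicator g x - χ x * g x) := by
    rw [integral_sub i1 i2, integral_indicator hE]
    ring
  have e2 : |∫ x, (E.indicator g x - χ x * g x)| ≤ ε := by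
    refine (abs_integral_le_integral_abs).trans ?_
    have : ∫ x, (O \ K).indicator (fun _ => (1 : ℝ)) x ≤ ε := by
      rw [integral_indicator_const _ hOKm, smul_eq_mul, mul_one]
      exact ENNReal.toReal_le_of_le_ofReal hε.le hOK.le
    refine le_trans (integral_mono (i1.sub i2).abs i3 fun x => ?_) this
    by_cases hxK : x ∈ K
    · simp [hKE hxK, hχK' x hxK, hxK]
    · by_cases hxO : x ∈ O
      · rw [indicator_of_mem (show x ∈ O \ K from ⟨hxO, hxK⟩)]
        by_cases hxE : x ∈ E
        · rw [indicator_of_mem hxE, ← one_sub_mul, abs_mul, abs_of_nonneg (sub_nonneg.2 (hχ1 x))]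
          exact mul_le_one₀ (by linarith [hχ0 x]) (abs_nonneg _) (hg1 x)
        · rw [indicator_of_notMem hxE, zero_sub, abs_neg, abs_mul]
          exact mul_le_one₀ (habs x) (abs_nonneg _) (hg1 x)
      · have hxE : x ∉ E := fun h => hxO (hEO h)
        simp [hxE, hxO, hχ.eq_zero_of_notMem fun h => hxO h.1]
  rw [e1]
  exact (abs_add_le _ _).trans (add_le_add (h χ (hχ.mono inter_subset_right) habs) e2)

/-- Translations of a set of finite variation are close to it in measure. -/
theorem abs_setIntegral_indicator_add_sub_le (hΩ : IsOpen Ω) (hA : MeasurableSet A)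
    (hfin : variationOpen A U ≠ ⊤) {r : ℝ} (hr : ∀ x ∈ Ω, Metric.closedBall x r ⊆ U)
    {z : Sp N} (hz : ‖z‖ ≤ r) (hE : MeasurableSet E) (hEΩ : E ⊆ Ω) (hEfin : volume E ≠ ⊤) :
    |∫ x in E, (A.indicator (fun _ => (1 : ℝ)) (x + z) - A.indicator (fun _ => (1 : ℝ)) x)| ≤
      r * (variationOpen A U).toReal := by
  have hm : Measurable (A.indicator fun _ => (1 : ℝ)) := measurable_const.indicator hA
  refine abs_setIntegral_le_of_forall_isTest hΩ ((hm.comp (measurable_add_const z)).sub hm) ?_ ?_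
    hE hEΩ hEfin
  · intro x
    by_cases h1 : x + z ∈ A <;> by_cases h2 : x ∈ A <;> simp [h1, h2]
  · intro χ hχ hχ1
    have hbd : ∀ (B : Set (Sp N)), MeasurableSet B →
        Integrable fun x => χ x * B.indicator (fun _ => (1 : ℝ)) x := by
      intro B hB
      have : (fun x => χ x * B.indicator (fun _ => (1 : ℝ)) x) = B.indicator χ := by
        ext1 x
        by_cases hx : x ∈ B <;> simp [hx]
      rw [this]
      exact hχ.integrable.indicator hB
    have e1 : ∫ x, χ x * A.indicator (fun _ => (1 : ℝ)) x = ∫ y in A, χ y := by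
      rw [← integral_indicator hA]
      refine integral_congr_ae (Eventually.of_forall fun x => ?_)
      by_cases hx : x ∈ A <;> simp [hx]
    have e2 : ∫ x, χ x * A.indicator (fun _ => (1 : ℝ)) (x + z) = ∫ y in A, χ (y - z) := by
      rw [← integral_indicator hA, ← integral_add_right_eq_self (A.indicator _) z]
      refine integral_congr_ae (Eventually.of_forall fun x => ?_)
      by_cases hx : x + z ∈ A <;> simp [hx]
    have i2 : Integrable fun x => χ x * A.indicator (fun _ => (1 : ℝ)) (x + z) :=
      hbd ((fun x => x + z) ⁻¹' A) (measurable_add_const z hA)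
    have e3 : ∫ x, χ x * ((A.indicator fun _ => (1 : ℝ)) (x + z) - A.indicator (fun _ => 1) x) =
        (∫ y in A, χ (y - z)) - ∫ y in A, χ y := by
      simp only [mul_sub]
      rw [integral_sub i2 (hbd A hA), e1, e2]
    refine (congrArg abs e3).trans_le ?_
    exact abs_setIntegral_comp_sub_sub_le hA hfin hr hχ hχ1 hz

theorem setIntegral_closedBall_indicator_add (hA : MeasurableSet A) (x : Sp N) (r : ℝ) :
    ∫ z in Metric.closedBall 0 r, A.indicator (fun _ => (1 : ℝ)) (x + z) =
      volume.real (A ∩ Metric.closedBall x r) := by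
  rw [← integral_indicator Metric.isClosed_closedBall.measurableSet]
  have e : ∀ z, (Metric.closedBall (0 : Sp N) r).indicator
      (fun z => A.indicator (fun _ => (1 : ℝ)) (x + z)) z =
      (A ∩ Metric.closedBall x r).indicator (fun _ => (1 : ℝ)) (x + z) := by
    intro z
    by_cases h1 : ‖z‖ ≤ r <;> by_cases h2 : x + z ∈ A <;> simp [indicator, h1, h2]
  simp only [e]
  rw [integral_add_left_eq_self (fun y => (A ∩ Metric.closedBall x r).indicator
    (fun _ => (1 : ℝ)) y) x, integral_indicator_const _
    (hA.inter Metric.isClosed_closedBall.measurableSet), smul_eq_mul, mul_one]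

/-- Averaging a set of finite variation over balls of radius `r` changes it by `O(r)` in mean. -/
theorem abs_setIntegral_average_sub_le (hΩ : IsOpen Ω) (hA : MeasurableSet A)
    (hfin : variationOpen A U ≠ ⊤) {r : ℝ} (hr : ∀ x ∈ Ω, Metric.closedBall x r ⊆ U)
    (hE : MeasurableSet E) (hEΩ : E ⊆ Ω) (hEfin : volume E ≠ ⊤) :
    |∫ x in E, (volume.real (A ∩ Metric.closedBall x r) -
        volume.real (Metric.closedBall (0 : Sp N) r) * A.indicator (fun _ => (1 : ℝ)) x)| ≤
      r * (variationOpen A U).toReal * volume.real (Metric.closedBall (0 : Sp N) r) := by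
  have hm : Measurable (A.indicator fun _ => (1 : ℝ)) := measurable_const.indicator hA
  have hBfin : volume (Metric.closedBall (0 : Sp N) r) < ⊤ := measure_closedBall_lt_top
  have : IsFiniteMeasure (volume.restrict E) := ⟨by simpa using hEfin.lt_top⟩
  have : IsFiniteMeasure (volume.restrict (Metric.closedBall (0 : Sp N) r)) :=
    ⟨by simpa using hBfin⟩
  have hmeas : Measurable fun p : Sp N × Sp N => A.indicator (fun _ => (1 : ℝ)) (p.1 + p.2) -
      A.indicator (fun _ => (1 : ℝ)) p.1 :=
    (hm.comp (measurable_fst.add measurable_snd)).sub (hm.comp measurable_fst)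
  have hInt : Integrable (fun p : Sp N × Sp N => A.indicator (fun _ => (1 : ℝ)) (p.1 + p.2) -
      A.indicator (fun _ => (1 : ℝ)) p.1)
      ((volume.restrict E).prod (volume.restrict (Metric.closedBall (0 : Sp N) r))) := by
    refine Integrable.of_bound hmeas.aestronglyMeasurable 1 (Eventually.of_forall fun p => ?_)
    by_cases h1 : p.1 + p.2 ∈ A <;> by_cases h2 : p.1 ∈ A <;> simp [h1, h2]
  have e : ∀ x, volume.real (A ∩ Metric.closedBall x r) -
      volume.real (Metric.closedBall (0 : Sp N) r) * A.indicator (fun _ => (1 : ℝ)) x =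
      ∫ z in Metric.closedBall 0 r, (A.indicator (fun _ => (1 : ℝ)) (x + z) -
        A.indicator (fun _ => (1 : ℝ)) x) := by
    intro x
    rw [integral_sub _ (integrable_const _), setIntegral_closedBall_indicator_add hA,
      setIntegral_const, smul_eq_mul]
    refine Integrable.of_bound (hm.comp (measurable_const_add x)).aestronglyMeasurable 1
      (Eventually.of_forall fun z => ?_)
    by_cases h1 : x + z ∈ A <;> simp [h1]
  simp only [e]
  -- Fubini puts the integral over E inside, where the translation estimate applies for each fixed
  -- z.
  rw [integral_integral_swap hInt]
  refine norm_setIntegral_le_of_norm_le_const (f := fun z => ∫ x in E,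
    (A.indicator (fun _ => (1 : ℝ)) (x + z) - A.indicator (fun _ => (1 : ℝ)) x)) hBfin fun z hz => ?_
  exact abs_setIntegral_indicator_add_sub_le hΩ hA hfin hr (mem_closedBall_zero_iff.1 hz) hE hEΩ hEfin

end Translation

/-! ### Compactness of sets with bounded variation -/

section Compactness

variable {N : ℕ} {Ω U : Set (Sp N)}

/-- The functional `h ↦ ∫_A h` on `L¹`. -/
def integralOver (A : Set (Sp N)) : StrongDual ℝ (Lp ℝ 1 (volume : Measure (Sp N))) :=
  LinearMap.mkContinuous
    { toFun := fun h => ∫ x in A, h x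
      map_add' := fun h h' => by
        rw [← integral_add (L1.integrable_coeFn h).integrableOn
          (L1.integrable_coeFn h').integrableOn]
        exact integral_congr_ae (ae_restrict_of_ae (Lp.coeFn_add h h'))
      map_smul' := fun c h => by
        rw [RingHom.id_apply, ← integral_smul]
        exact integral_congr_ae (ae_restrict_of_ae (Lp.coeFn_smul c h)) } 1 fun h => by
    rw [one_mul, L1.norm_eq_integral_norm]
    exact (norm_integral_le_integral_norm _).trans
      (setIntegral_le_integral (L1.integrable_coeFn h).norm
        (Eventually.of_forall fun x => norm_nonneg _))

/-- The functionals `integralOver (An n)` lie in the unit ball of the dual of the separable space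
L¹, which is weak-* sequentially compact. Evaluation at 𝟙_B gives the claim with one subsequence for
all B. -/
theorem exists_subseq_tendsto_measureReal_inter (An : ℕ → Set (Sp N)) :
    ∃ φ : ℕ → ℕ, StrictMono φ ∧ ∀ B : Set (Sp N), MeasurableSet B → volume B ≠ ⊤ →
      ∃ l : ℝ, Tendsto (fun n => volume.real (An (φ n) ∩ B)) atTop (𝓝 l) := by
  have hle : ∀ A : Set (Sp N), ‖integralOver A‖ ≤ 1 := fun A =>
    LinearMap.mkContinuous_norm_le _ zero_le_one _
  have : Fact ((1 : ℝ≥0∞) ≠ ⊤) := ⟨ENNReal.one_ne_top⟩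
  have hcpt := WeakDual.isSeqCompact_closedBall ℝ (Lp ℝ 1 (volume : Measure (Sp N))) 0 1
  obtain ⟨a, -, φ, hφ, hlim⟩ := hcpt
    (x := fun n => StrongDual.toWeakDual (integralOver (An n))) fun n => by
      simpa using hle (An n)
  refine ⟨φ, hφ, fun B hB hBfin => ?_⟩
  rw [tendsto_iff_forall_eval_tendsto_topDualPairing] at hlim
  refine ⟨_, (hlim (indicatorConstLp 1 hB hBfin (1 : ℝ))).congr fun n => ?_⟩
  change ∫ x in An (φ n), indicatorConstLp 1 hB hBfin (1 : ℝ) x = _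
  rw [integral_congr_ae (ae_restrict_of_ae indicatorConstLp_coeFn), integral_indicator_const _ hB,
    smul_eq_mul, mul_one, measureReal_restrict_apply hB, inter_comm]

end Compactness

section Compactness

variable {N : ℕ} {A E Ω U : Set (Sp N)}

theorem measureReal_inter_closedBall_le (A : Set (Sp N)) (x : Sp N) (r : ℝ) :
    volume.real (A ∩ Metric.closedBall x r) ≤ volume.real (Metric.closedBall (0 : Sp N) r) := by
  have h : volume.real (Metric.closedBall x r) = volume.real (Metric.closedBall (0 : Sp N) r) := by
    rw [measureReal_def, measureReal_def, Measure.addHaar_closedBall_center]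
  rw [← h]
  exact measureReal_mono inter_subset_right measure_closedBall_lt_top.ne

theorem integrableOn_measureReal_inter_closedBall (hA : MeasurableSet A) (hE : volume E ≠ ⊤)
    (r : ℝ) : IntegrableOn (fun x => volume.real (A ∩ Metric.closedBall x r)) E := by
  have hm : Measurable fun p : Sp N × Sp N => A.indicator (fun _ => (1 : ℝ)) (p.1 + p.2) :=
    (measurable_const.indicator hA).comp (measurable_fst.add measurable_snd)
  have h := (hm.stronglyMeasurable.integral_prod_right'
    (ν := volume.restrict (Metric.closedBall (0 : Sp N) r)))
  simp only [setIntegral_closedBall_indicator_add hA] at h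
  refine Measure.integrableOn_of_bounded hE h.aestronglyMeasurable
    (M := volume.real (Metric.closedBall (0 : Sp N) r)) (Eventually.of_forall fun x => ?_)
  rw [Real.norm_eq_abs, abs_of_nonneg measureReal_nonneg]
  exact measureReal_inter_closedBall_le A x r

/-- On Ω ∩ (A \ B) the indicators differ by exactly 1. Replacing each by its ball average costs one
translation error, which accounts for the factor 2, and leaves the difference of averages. -/
theorem measureReal_inter_sdiff_le (hΩ : IsOpen Ω) (hΩfin : volume Ω ≠ ⊤) {A B : Set (Sp N)}
    (hA : MeasurableSet A) (hB : MeasurableSet B) {c : ℝ≥0∞} (hc : c ≠ ⊤)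
    (hAc : variationOpen A U ≤ c) (hBc : variationOpen B U ≤ c) {r : ℝ} (hr0 : 0 ≤ r)
    (hr : ∀ x ∈ Ω, Metric.closedBall x r ⊆ U) :
    volume.real (Metric.closedBall (0 : Sp N) r) * volume.real (Ω ∩ (A \ B)) ≤
      (∫ x in Ω, |volume.real (A ∩ Metric.closedBall x r) -
        volume.real (B ∩ Metric.closedBall x r)|) +
      2 * (r * c.toReal * volume.real (Metric.closedBall (0 : Sp N) r)) := by
  set b := volume.real (Metric.closedBall (0 : Sp N) r) with hb
  set S := Ω ∩ (A \ B)
  have hS : MeasurableSet S := hΩ.measurableSet.inter (hA.diff hB)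
  have hSΩ : S ⊆ Ω := inter_subset_left
  have hSfin : volume S ≠ ⊤ := measure_ne_top_of_subset hSΩ hΩfin
  have key : ∀ D : Set (Sp N), MeasurableSet D → variationOpen D U ≤ c →
      |∫ x in S, (volume.real (D ∩ Metric.closedBall x r) -
        b * D.indicator (fun _ => (1 : ℝ)) x)| ≤ r * c.toReal * b := by
    intro D hD hDc
    refine (abs_setIntegral_average_sub_le hΩ hD (hDc.trans_lt hc.lt_top).ne hr hS hSΩ hSfin).trans ?_
    gcongr
  have iA := integrableOn_measureReal_inter_closedBall hA hSfin r
  have iB := integrableOn_measureReal_inter_closedBall hB hSfin r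
  have hAΩ := integrableOn_measureReal_inter_closedBall hA hΩfin r
  have hBΩ := integrableOn_measureReal_inter_closedBall hB hΩfin r
  have eA : ∫ x in S, (volume.real (A ∩ Metric.closedBall x r) -
      b * A.indicator (fun _ => (1 : ℝ)) x) =
      (∫ x in S, volume.real (A ∩ Metric.closedBall x r)) - b * volume.real S := by
    have : ∀ x ∈ S, volume.real (A ∩ Metric.closedBall x r) -
        b * A.indicator (fun _ => (1 : ℝ)) x = volume.real (A ∩ Metric.closedBall x r) - b :=
      fun x hx => by rw [indicator_of_mem hx.2.1, mul_one]
    rw [setIntegral_congr_fun hS this, integral_sub iA (integrableOn_const hSfin),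
      setIntegral_const, smul_eq_mul, mul_comm b]
  have eB : ∫ x in S, (volume.real (B ∩ Metric.closedBall x r) -
      b * B.indicator (fun _ => (1 : ℝ)) x) =
      ∫ x in S, volume.real (B ∩ Metric.closedBall x r) :=
    setIntegral_congr_fun hS fun x hx => by
      simp only [indicator_of_notMem hx.2.2, mul_zero, sub_zero]
  have hA' := abs_le.1 (key A hA hAc)
  have hB' := abs_le.1 (key B hB hBc)
  rw [eA] at hA'
  rw [eB] at hB'
  have h1 : (∫ x in S, volume.real (A ∩ Metric.closedBall x r)) -
      ∫ x in S, volume.real (B ∩ Metric.closedBall x r) ≤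
      ∫ x in Ω, |volume.real (A ∩ Metric.closedBall x r) -
        volume.real (B ∩ Metric.closedBall x r)| := by
    rw [← integral_sub iA iB]
    refine (integral_mono (iA.sub iB) (iA.sub iB).abs fun x => le_abs_self _).trans ?_
    exact setIntegral_mono_set (hAΩ.sub hBΩ).abs (Eventually.of_forall fun x => abs_nonneg _)
      hSΩ.eventuallyLE
  linarith [hA'.1, hB'.2]

/-- Compactness of sets of bounded variation: membership stabilizes along a subsequence at almost
every point. -/
theorem exists_subseq_ae_eventually_mem_iff (hΩ : IsOpen Ω) (hΩb : Bornology.IsBounded Ω)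
    (hU : IsOpen U) (hΩU : closure Ω ⊆ U) {An : ℕ → Set (Sp N)} (hAn : ∀ n, MeasurableSet (An n))
    {c : ℝ≥0∞} (hc : c ≠ ⊤) (h : ∀ n, variationOpen (An n) U ≤ c) :
    ∃ φ : ℕ → ℕ, StrictMono φ ∧ ∀ᵐ x, x ∈ Ω →
      ∃ n₀, ∀ n ≥ n₀, (x ∈ An (φ n) ↔ x ∈ An (φ n₀)) := by
  have hΩfin : volume Ω ≠ ⊤ := hΩb.measure_lt_top.ne
  obtain ⟨φ, hφ, hlim⟩ := exists_subseq_tendsto_measureReal_inter An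
  obtain ⟨δ, hδ, hδU⟩ := hΩb.isCompact_closure.exists_cthickening_subset_open hU hΩU
  have hcauchy : ∀ ε : ℝ, 0 < ε → ∃ n₀, ∀ m ≥ n₀, ∀ n ≥ n₀,
      volume.real (Ω ∩ (An (φ m) \ An (φ n))) ≤ ε := by
    intro ε hε
    -- The radius keeps the balls inside U and makes the two averaging errors cost at most ε / 2;
    -- the averages, at this fixed r, account for the other half.
    set r : ℝ := min δ (ε / (4 * (c.toReal + 1))) with hrdef
    have hc0 : 0 ≤ c.toReal := ENNReal.toReal_nonneg
    have hr0 : 0 < r := lt_min hδ (by positivity)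
    have hrc : 2 * (r * c.toReal) ≤ ε / 2 := by
      have h1 : r * (4 * (c.toReal + 1)) ≤ ε :=
        (le_div_iff₀ (by positivity)).1 (min_le_right _ _)
      nlinarith
    have hr : ∀ x ∈ Ω, Metric.closedBall x r ⊆ U := fun x hx =>
      ((Metric.closedBall_subset_closedBall (min_le_left _ _)).trans
        (Metric.closedBall_subset_cthickening (subset_closure hx) δ)).trans hδU
    set b := volume.real (Metric.closedBall (0 : Sp N) r) with hb
    have hb0 : 0 < b := ENNReal.toReal_pos (Metric.measure_closedBall_pos _ _ hr0).ne'
      measure_closedBall_lt_top.ne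
    -- With r fixed, weak-* convergence makes the ball measures converge at every centre x, with the
    -- dominating constant b.
    have hdom : Tendsto (fun p : ℕ × ℕ => ∫ x in Ω,
        |volume.real (An (φ p.1) ∩ Metric.closedBall x r) -
          volume.real (An (φ p.2) ∩ Metric.closedBall x r)|) (atTop ×ˢ atTop) (𝓝 0) := by
      have : Tendsto (fun p : ℕ × ℕ => ∫ x in Ω,
        |volume.real (An (φ p.1) ∩ Metric.closedBall x r) -
          volume.real (An (φ p.2) ∩ Metric.closedBall x r)|) (atTop ×ˢ atTop)
          (𝓝 (∫ x in Ω, (0 : ℝ))) := by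
        refine tendsto_integral_filter_of_dominated_convergence (fun _ => b)
          (Eventually.of_forall fun p => ?_)
          (Eventually.of_forall fun p => Eventually.of_forall fun x => ?_)
          (integrableOn_const hΩfin) (Eventually.of_forall fun x => ?_)
        · exact ((integrableOn_measureReal_inter_closedBall (hAn _) hΩfin r).sub
            (integrableOn_measureReal_inter_closedBall (hAn _) hΩfin r)).abs.aestronglyMeasurable
        · rw [Real.norm_eq_abs, abs_abs, abs_le]
          have h1 := measureReal_inter_closedBall_le (An (φ p.1)) x r
          have h2 := measureReal_inter_closedBall_le (An (φ p.2)) x r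
          have h3 : 0 ≤ volume.real (An (φ p.1) ∩ Metric.closedBall x r) := measureReal_nonneg
          have h4 : 0 ≤ volume.real (An (φ p.2) ∩ Metric.closedBall x r) := measureReal_nonneg
          constructor <;> linarith
        · obtain ⟨l, hl⟩ := hlim (Metric.closedBall x r) Metric.isClosed_closedBall.measurableSet
            measure_closedBall_lt_top.ne
          simpa using ((hl.comp tendsto_fst).sub (hl.comp tendsto_snd)).abs
      simpa using this
    have hev := hdom.eventually_lt_const (show 0 < b * (ε / 2) by positivity)
    rw [prod_atTop_atTop_eq] at hev
    obtain ⟨⟨n₁, n₂⟩, hn⟩ := eventually_atTop.1 hev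
    refine ⟨max n₁ n₂, fun m hm n hn' => ?_⟩
    have h1 := hn (m, n) ⟨(le_max_left _ _).trans hm, (le_max_right _ _).trans hn'⟩
    have h2 := measureReal_inter_sdiff_le hΩ hΩfin (hAn (φ m)) (hAn (φ n)) hc (h _) (h _) hr0.le hr
    refine le_of_mul_le_mul_left ?_ hb0
    rw [← hb] at h2
    nlinarith
  -- Thinning out makes consecutive symmetric differences in Ω at most 2·2^{-n} in measure. By
  -- Borel–Cantelli almost every point lies in finitely many of them, so membership is eventually
  -- constant.
  obtain ⟨ψ, hψ, hψ'⟩ := extraction_forall_of_eventually'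
    (P := fun n k => ∀ m ≥ k, volume.real (Ω ∩ (An (φ m) \ An (φ k))) ≤ (1 / 2 : ℝ) ^ n ∧
      volume.real (Ω ∩ (An (φ k) \ An (φ m))) ≤ (1 / 2 : ℝ) ^ n) fun n => by
    obtain ⟨n₀, hn₀⟩ := hcauchy ((1 / 2 : ℝ) ^ n) (by positivity)
    exact ⟨n₀, fun k hk m hm => ⟨hn₀ m (hk.trans hm) k hk, hn₀ k hk m (hk.trans hm)⟩⟩
  refine ⟨φ ∘ ψ, hφ.comp hψ, ?_⟩
  set S : ℕ → Set (Sp N) := fun n => Ω ∩ (An (φ (ψ (n + 1))) \ An (φ (ψ n))) ∪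
    Ω ∩ (An (φ (ψ n)) \ An (φ (ψ (n + 1)))) with hSdef
  have hS : ∀ n, volume (S n) ≤ ENNReal.ofReal (2 * (1 / 2 : ℝ) ^ n) := by
    intro n
    have h1 := hψ' n (ψ (n + 1)) (hψ.monotone (Nat.le_succ n))
    have h2 : ∀ D : Set (Sp N), volume.real (Ω ∩ D) ≤ (1 / 2 : ℝ) ^ n →
        volume (Ω ∩ D) ≤ ENNReal.ofReal ((1 / 2 : ℝ) ^ n) := fun D hD =>
      (ENNReal.le_ofReal_iff_toReal_le (measure_ne_top_of_subset inter_subset_left hΩfin)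
        (by positivity)).2 hD
    rw [two_mul, ENNReal.ofReal_add (by positivity) (by positivity)]
    exact (measure_union_le _ _).trans (add_le_add (h2 _ h1.1) (h2 _ h1.2))
  have hsum : ∑' n, volume (S n) ≠ ⊤ :=
    ((ENNReal.tsum_le_tsum hS).trans_lt
      (Summable.tsum_ofReal_lt_top (summable_geometric_two.mul_left 2))).ne
  filter_upwards [ae_eventually_notMem hsum] with x hx hxΩ
  obtain ⟨n₀, hn₀⟩ := eventually_atTop.1 hx
  refine ⟨n₀, fun n hn => ?_⟩
  induction n, hn using Nat.le_induction with
  | base => rfl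
  | succ n hn ih =>
    refine Iff.trans ?_ ih
    have := hn₀ n hn
    simp only [hSdef, mem_union, mem_inter_iff, hxΩ, true_and, Set.mem_sdiff, not_or, not_and,
      not_not] at this
    exact ⟨this.1, this.2⟩

end Compactness

/-! ### Direct method for the optimal design -/

section Existence

variable {N d k : ℕ} {Ω : Set (Sp N)} {op : Coeffs N (Sp d) (Arr d N k)}
  {σ₁ σ₂ : Arr d N k →ₗ[ℝ] Arr d N k} {f : Linf Ω (Sp d)} {A A₀ : Set (Sp N)}

theorem coe_add_coe_ennreal {p : ℝ≥0∞} (hp : p ≠ ⊤) (r : ℝ) :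
    (r : EReal) + (p : EReal) = ((r + p.toReal : ℝ) : EReal) := by
  rw [EReal.coe_add, EReal.coe_ennreal_toReal hp]

theorem energyI_eq_bulkEnergy_add (u : L2 Ω (Sp d)) (A : Set (Sp N)) :
    energyI Ω op σ₁ σ₂ f u A =
      (bulkEnergy Ω op σ₁ σ₂ f u A : EReal) + (Per A (closure Ω) : EReal) :=
  rfl

theorem IsAdmissible.Per_ne_top (h : IsAdmissible Ω A₀ A) (hΩb : Bornology.IsBounded Ω) :
    Per A (closure Ω) ≠ ⊤ :=
  (h.1.2 _ hΩb.isCompact_closure).ne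

/-- The limit of a minimizing sequence of designs is a minimizer of `sup_u I_Ω(u, ·)`. -/
theorem exists_isAdmissible_supI_eq (hΩo : IsOpen Ω) (hΩb : Bornology.IsBounded Ω)
    (hstate : ∀ A, MeasurableSet A → ∃ w, IsState Ω op σ₁ σ₂ f A w)
    (hsup : ∀ A w, MeasurableSet A → IsState Ω op σ₁ σ₂ f A w →
      supI Ω op σ₁ σ₂ f A = energyI Ω op σ₁ σ₂ f w A)
    (hA₀ : IsLocallyFinitePerimeter A₀) :
    ∃ A, IsAdmissible Ω A₀ A ∧
      supI Ω op σ₁ σ₂ f A = ⨅ (A' : Set (Sp N)) (_ : IsAdmissible Ω A₀ A'), supI Ω op σ₁ σ₂ f A' := by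
  set m : EReal := ⨅ (A' : Set (Sp N)) (_ : IsAdmissible Ω A₀ A'), supI Ω op σ₁ σ₂ f A' with hm
  have henergy : ∀ {A}, IsAdmissible Ω A₀ A → ∀ u, energyI Ω op σ₁ σ₂ f u A =
      ((bulkEnergy Ω op σ₁ σ₂ f u A + (Per A (closure Ω)).toReal : ℝ) : EReal) := fun h u => by
    rw [energyI_eq_bulkEnergy_add, coe_add_coe_ennreal (h.Per_ne_top hΩb)]
  have hle : ∀ {A} {u : L2 Ω (Sp d)}, u ∈ WA0 k op Ω →
      energyI Ω op σ₁ σ₂ f u A ≤ supI Ω op σ₁ σ₂ f A := fun {A} {u} hu =>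
    le_iSup₂ (f := fun (u : L2 Ω (Sp d)) (_ : u ∈ WA0 k op Ω) => energyI Ω op σ₁ σ₂ f u A) u hu
  -- The competitor u = 0 has no bulk energy.
  have hPer : ∀ {A}, IsAdmissible Ω A₀ A →
      (((Per A (closure Ω)).toReal : ℝ) : EReal) ≤ supI Ω op σ₁ σ₂ f A := fun {A} h => by
    have h0 := hle (A := A) (zero_mem_WA0 hΩo)
    rwa [henergy h, bulkEnergy_zero hΩo hΩb h.1.1, zero_add] at h0
  have hm0 : 0 ≤ m := le_iInf₂ fun A' h' =>
    le_trans (EReal.coe_nonneg.2 ENNReal.toReal_nonneg) (hPer h')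
  have hmtop : m < ⊤ := by
    obtain ⟨w, hw⟩ := hstate A₀ hA₀.1
    refine lt_of_le_of_lt (iInf₂_le A₀ (isAdmissible_self hA₀)) ?_
    rw [hsup A₀ w hA₀.1 hw, henergy (isAdmissible_self hA₀)]
    exact EReal.coe_lt_top _
  obtain ⟨μ, hμ⟩ : ∃ μ : ℝ, (μ : EReal) = m :=
    ⟨m.toReal, EReal.coe_toReal hmtop.ne (ne_bot_of_le_ne_bot EReal.zero_ne_bot hm0)⟩
  have hseq : ∀ n : ℕ, ∃ A, IsAdmissible Ω A₀ A ∧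
      supI Ω op σ₁ σ₂ f A < ((μ + 1 / ((n : ℝ) + 1) : ℝ) : EReal) := by
    intro n
    have hlt : m < ((μ + 1 / ((n : ℝ) + 1) : ℝ) : EReal) := by
      rw [← hμ, EReal.coe_lt_coe_iff]
      linarith [show (0 : ℝ) < 1 / ((n : ℝ) + 1) by positivity]
    obtain ⟨A, hA⟩ := iInf_lt_iff.1 hlt
    obtain ⟨hadm, hA⟩ := iInf_lt_iff.1 hA
    exact ⟨A, hadm, hA⟩
  choose An hAn hAnlt using hseq
  have hAnPer : ∀ n, Per (An n) (closure Ω) ≤ ENNReal.ofReal (μ + 1) := by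
    intro n
    have h1 := (hPer (hAn n)).trans (hAnlt n).le
    rw [EReal.coe_le_coe_iff] at h1
    rw [← ENNReal.ofReal_toReal ((hAn n).Per_ne_top hΩb)]
    refine ENNReal.ofReal_le_ofReal (h1.trans (add_le_add le_rfl ?_))
    rw [div_le_one (by positivity)]
    linarith [(Nat.cast_nonneg n : (0 : ℝ) ≤ n)]
  set U := Metric.thickening 1 (closure Ω) with hU
  have hUfin := variationOpen_lt_top_of_isLocallyFinitePerimeter hA₀
    ((hΩb.closure.thickening (δ := 1)).subset (sdiff_subset (s := U) (t := closure Ω)))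
  obtain ⟨φ, hφ, hae⟩ := exists_subseq_ae_eventually_mem_iff hΩo hΩb Metric.isOpen_thickening
    (Metric.self_subset_thickening one_pos (closure Ω)) (fun n => (hAn n).1.1)
    (ENNReal.add_lt_top.2 ⟨ENNReal.ofReal_lt_top, hUfin⟩).ne
    fun n => (variationOpen_le_Per_add hΩb hA₀ (hAn n) U).trans (add_le_add (hAnPer n) le_rfl)
  -- The limit is taken as a set-theoretic liminf, which is Borel by construction.
  set A : Set (Sp N) := ⋃ n₀, ⋂ n ≥ n₀, An (φ n) with hAdef
  have hAmem : ∀ x, x ∈ A ↔ ∃ n₀, ∀ n ≥ n₀, x ∈ An (φ n) := fun x => by simp [hAdef]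
  have hAmeas : MeasurableSet A :=
    MeasurableSet.iUnion fun n₀ => MeasurableSet.iInter fun n => MeasurableSet.iInter fun _ =>
      (hAn (φ n)).1.1
  have hlim : ∀ᵐ x, ∀ᶠ n in atTop, (x ∈ An (φ n) ↔ x ∈ A) := by
    filter_upwards [hae, ae_all_iff.2 fun n => (hAn (φ n)).ae_mem_iff] with x hx hx'
    have hst : ∃ n₀, ∀ n ≥ n₀, (x ∈ An (φ n) ↔ x ∈ An (φ n₀)) := by
      by_cases hxΩ : x ∈ Ω
      · exact hx hxΩ
      -- Outside Ω all designs agree with A₀, so membership is constant from the start.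
      · exact ⟨0, fun n _ => (hx' n hxΩ).trans (hx' 0 hxΩ).symm⟩
    obtain ⟨n₀, hn₀⟩ := hst
    refine eventually_atTop.2 ⟨n₀, fun n hn => ?_⟩
    rw [hn₀ n hn, hAmem]
    refine ⟨fun h => ⟨n₀, fun j hj => (hn₀ j hj).2 h⟩, fun ⟨n₁, hn₁⟩ => ?_⟩
    exact (hn₀ (max n₀ n₁) (le_max_left _ _)).1 (hn₁ _ (le_max_right _ _))
  have hAadm : IsAdmissible Ω A₀ A := isAdmissible_of_tendsto hΩb hA₀ (fun n => hAn (φ n)) hAmeas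
    hlim ENNReal.ofReal_ne_top (Eventually.of_forall fun n => hAnPer (φ n))
  refine ⟨A, hAadm, le_antisymm (iSup₂_le fun u hu => ?_) (iInf₂_le A hAadm)⟩
  rw [henergy hAadm, ← hμ, EReal.coe_le_coe_iff]
  refine le_of_forall_pos_le_add fun ε hε => ?_
  have hbulk := tendsto_bulkEnergy (op := op) (σ₁ := σ₁) (σ₂ := σ₂) (f := f) hΩo u
    (fun n => (hAn (φ n)).1.1) (ae_restrict_of_ae hlim)
  have hone : Tendsto (fun n : ℕ => 1 / ((φ n : ℝ) + 1)) atTop (𝓝 0) :=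
    tendsto_one_div_add_atTop_nhds_zero_nat.comp hφ.tendsto_atTop
  -- The index n is minimizing up to 1 / (φ n + 1); subtracting the convergent bulk energy of the
  -- fixed u leaves a bound on the perimeter, to which lower semicontinuity applies.
  have hev : ∀ᶠ n in atTop, (Per (An (φ n)) (closure Ω)).toReal ≤
      μ + ε - bulkEnergy Ω op σ₁ σ₂ f u A := by
    filter_upwards [hbulk.eventually_const_lt
      (show bulkEnergy Ω op σ₁ σ₂ f u A - ε / 2 < bulkEnergy Ω op σ₁ σ₂ f u A by linarith),
      hone.eventually_lt_const (half_pos hε)] with n h1 h2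
    have h3 := (hle (A := An (φ n)) hu).trans (hAnlt (φ n)).le
    rw [henergy (hAn (φ n)), EReal.coe_le_coe_iff] at h3
    linarith
  obtain ⟨n, hn⟩ := hev.exists
  have hnn : 0 ≤ μ + ε - bulkEnergy Ω op σ₁ σ₂ f u A := ENNReal.toReal_nonneg.trans hn
  have hP : Per A (closure Ω) ≤ ENNReal.ofReal (μ + ε - bulkEnergy Ω op σ₁ σ₂ f u A) := by
    refine Per_le_of_tendsto hΩb hA₀ (fun n => hAn (φ n)) hAmeas hlim ?_
    filter_upwards [hev] with n hn
    exact (ENNReal.le_ofReal_iff_toReal_le ((hAn (φ n)).Per_ne_top hΩb) hnn).2 hn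
  have := ENNReal.toReal_le_of_le_ofReal hnn hP
  linarith

end Existence

end OptimalDesign

end

/-! ### Proof of the theorem -/

open OptimalDesign
theorem theorem1p1 {N d k : ℕ} (hN : 2 ≤ N) (hd : 0 < d) (hk : 0 < k)
    (Ω : Set (Sp N)) (hΩne : Ω.Nonempty) (hΩo : IsOpen Ω) (hΩb : Bornology.IsBounded Ω)
    (hΩL : HasLipschitzBoundary Ω)
    (f : Linf Ω (Sp d))
    (σ₁ σ₂ : Arr d N k →ₗ[ℝ] Arr d N k) (hσ₁ : σ₁.IsSymmetric) (hσ₂ : σ₂.IsSymmetric)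
    (M : ℝ) (hM : 0 < M)
    (hσ₁M : ∀ P : Arr d N k, 1 / M * ‖P‖ ^ 2 ≤ inner ℝ (σ₁ P) P ∧ inner ℝ (σ₁ P) P ≤ M * ‖P‖ ^ 2)
    (hσ₂M : ∀ P : Arr d N k, 1 / M * ‖P‖ ^ 2 ≤ inner ℝ (σ₂ P) P ∧ inner ℝ (σ₂ P) P ≤ M * ‖P‖ ^ 2)
    (op : Coeffs N (Sp d) (Arr d N k)) (hop : IsGradientForm Ω op)
    (A₀ : Set (Sp N)) (hA₀ : IsLocallyFinitePerimeter A₀) :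
    (∃ (w : L2 Ω (Sp d)) (A : Set (Sp N)), IsSolutionP Ω op σ₁ σ₂ f A₀ w A) ∧
    (∀ A : Set (Sp N), MeasurableSet A → ∃! u : L2 Ω (Sp d), IsState Ω op σ₁ σ₂ f A u) ∧
    (∀ (w : L2 Ω (Sp d)) (A : Set (Sp N)), IsSolutionP Ω op σ₁ σ₂ f A₀ w A →
      w = stateSol Ω op σ₁ σ₂ f A) ∧
    Set.BijOn (fun p : L2 Ω (Sp d) × Set (Sp N) => (stateSol Ω op σ₁ σ₂ f p.2, p.2))
      {p | IsSolutionP Ω op σ₁ σ₂ f A₀ p.1 p.2}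
      {p | IsOptimalDesign Ω op σ₁ σ₂ f A₀ p.1 p.2} := by
  obtain ⟨⟨C₀, hKorn, -⟩, -⟩ := hop
  obtain ⟨C, hC0, hC⟩ := exists_integral_norm_sq_le_applyOp (by omega) hk hΩne hΩo hΩb op C₀ hKorn
  have hm : 0 < 1 / M := by positivity
  have hstate : ∀ A, MeasurableSet A → ∃ w, IsState Ω op σ₁ σ₂ f A w := fun A hA =>
    exists_isState hΩo hΩb hC0 hC hm (fun P => (hσ₁M P).1) (fun P => (hσ₂M P).1) hA
  have hbulk : ∀ {A : Set (Sp N)} {u w : L2 Ω (Sp d)}, MeasurableSet A →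
      IsState Ω op σ₁ σ₂ f A w → u ∈ WA0 k op Ω →
      bulkEnergy Ω op σ₁ σ₂ f u A + 1 / M / C * ‖u - w‖ ^ 2 ≤ bulkEnergy Ω op σ₁ σ₂ f w A :=
    fun hA hw hu => by
      rw [bulkEnergy_state hΩo hΩb hA hw]
      exact bulkEnergy_add_le hΩo hΩb hC0 hC hm hσ₁ hσ₂ (fun P => (hσ₁M P).1)
        (fun P => (hσ₂M P).1) hA hw hu
  -- The quadratic gap forces every maximizer of the bulk energy to be the state.
  have heq : ∀ {A : Set (Sp N)} {u w : L2 Ω (Sp d)}, MeasurableSet A →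
      IsState Ω op σ₁ σ₂ f A w → u ∈ WA0 k op Ω →
      bulkEnergy Ω op σ₁ σ₂ f w A ≤ bulkEnergy Ω op σ₁ σ₂ f u A → u = w := by
    intro A u w hA hw hu hle
    have h1 := hbulk hA hw hu
    have h2 : 1 / M / C * ‖u - w‖ ^ 2 ≤ 0 := by linarith
    have h3 : ‖u - w‖ ^ 2 ≤ 0 := nonpos_of_mul_nonpos_right h2 (by positivity)
    exact sub_eq_zero.1 (norm_eq_zero.1 (pow_eq_zero_iff two_ne_zero |>.1
      (le_antisymm h3 (by positivity))))
  have hle : ∀ {A : Set (Sp N)} {u w : L2 Ω (Sp d)}, MeasurableSet A →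
      IsState Ω op σ₁ σ₂ f A w → u ∈ WA0 k op Ω →
      bulkEnergy Ω op σ₁ σ₂ f u A ≤ bulkEnergy Ω op σ₁ σ₂ f w A := fun hA hw hu =>
    le_trans (le_add_of_nonneg_right (by positivity)) (hbulk hA hw hu)
  have huniq : ∀ {A : Set (Sp N)} {u w : L2 Ω (Sp d)}, MeasurableSet A →
      IsState Ω op σ₁ σ₂ f A u → IsState Ω op σ₁ σ₂ f A w → u = w := fun hA hu hw =>
    heq hA hw hu.1 (hle hA hu hw.1)
  have hsol : ∀ {A : Set (Sp N)}, MeasurableSet A →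
      IsState Ω op σ₁ σ₂ f A (stateSol Ω op σ₁ σ₂ f A) := fun {A} hA => by
    rw [stateSol, dif_pos (hstate A hA)]
    exact (hstate A hA).choose_spec
  have hsup : ∀ A w, MeasurableSet A → IsState Ω op σ₁ σ₂ f A w →
      supI Ω op σ₁ σ₂ f A = energyI Ω op σ₁ σ₂ f w A := fun A w hA hw =>
    le_antisymm (iSup₂_le fun u hu => add_le_add_left (EReal.coe_le_coe_iff.2 (hle hA hw hu)) _)
      (le_iSup₂ (f := fun (u : L2 Ω (Sp d)) (_ : u ∈ WA0 k op Ω) =>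
        energyI Ω op σ₁ σ₂ f u A) w hw.1)
  -- The maximal bulk energy is ∫ f·w_A, so both problems minimize the same function of the design.
  have hsupE : ∀ {A : Set (Sp N)}, MeasurableSet A →
      supI Ω op σ₁ σ₂ f A = energyE Ω op σ₁ σ₂ f A := fun {A} hA => by
    rw [hsup A _ hA (hsol hA), energyI_eq_bulkEnergy_add, bulkEnergy_state hΩo hΩb hA (hsol hA)]
    rfl
  have hwA : ∀ (w : L2 Ω (Sp d)) (A : Set (Sp N)), IsSolutionP Ω op σ₁ σ₂ f A₀ w A →
      w = stateSol Ω op σ₁ σ₂ f A := by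
    rintro w A ⟨hadm, hw, hmax, -⟩
    have hA := hadm.1.1
    refine heq hA (hsol hA) hw ?_
    -- The perimeter of an admissible design is finite, so it cancels in `EReal`.
    rw [hsup A _ hA (hsol hA), energyI_eq_bulkEnergy_add, energyI_eq_bulkEnergy_add,
      coe_add_coe_ennreal (hadm.Per_ne_top hΩb), coe_add_coe_ennreal (hadm.Per_ne_top hΩb),
      EReal.coe_eq_coe_iff] at hmax
    linarith
  have hmin : ∀ {A : Set (Sp N)}, IsAdmissible Ω A₀ A →
      ((supI Ω op σ₁ σ₂ f A =
        ⨅ (A' : Set (Sp N)) (_ : IsAdmissible Ω A₀ A'), supI Ω op σ₁ σ₂ f A') ↔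
      ∀ A' : Set (Sp N), IsAdmissible Ω A₀ A' →
        energyE Ω op σ₁ σ₂ f A ≤ energyE Ω op σ₁ σ₂ f A') := by
    intro A hadm
    constructor
    · intro h A' hA'
      rw [← hsupE hadm.1.1, ← hsupE hA'.1.1, h]
      exact iInf₂_le A' hA'
    · intro h
      refine le_antisymm (le_iInf₂ fun A' hA' => ?_) (iInf₂_le A hadm)
      rw [hsupE hadm.1.1, hsupE hA'.1.1]
      exact h A' hA'
  refine ⟨?_, fun A hA => ⟨_, hsol hA, fun u hu => huniq hA hu (hsol hA)⟩, hwA, ?_, ?_, ?_⟩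
  · obtain ⟨A, hadm, hA⟩ := exists_isAdmissible_supI_eq hΩo hΩb hstate hsup hA₀
    exact ⟨_, A, hadm, (hsol hadm.1.1).1, (hsup A _ hadm.1.1 (hsol hadm.1.1)).symm, hA⟩
  · rintro ⟨w, A⟩ ⟨hadm, -, -, hinf⟩
    exact ⟨hadm, hsol hadm.1.1, (hmin hadm).1 hinf⟩
  -- On solutions of (P) the first component is determined by the design, so equal designs give
  -- equal pairs.
  · rintro ⟨w, A⟩ h ⟨w', A'⟩ h' he
    obtain rfl : A = A' := congrArg Prod.snd he
    rw [hwA w A h, hwA w' A h']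
  · rintro ⟨u, A⟩ ⟨hadm, hu, hE⟩
    have hA := hadm.1.1
    exact ⟨(stateSol Ω op σ₁ σ₂ f A, A), ⟨hadm, (hsol hA).1, (hsup A _ hA (hsol hA)).symm,
      (hmin hadm).2 hE⟩, Prod.ext (huniq hA (hsol hA) hu) rfl⟩
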